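/- Let $n$ be a nonzero integer. Consider the integer quadratic polynomials $f(x)=ax^2+bx+c$ ($a,b,c\in\mathbb Z$, $a\neq 0$) with $$I(f)=a(b^2-4ac)=n,$$ and call two of them equivalent if one is obtained from the other by a substitution $x\mapsto x+t$ with $t\in\mathbb Z$. Then the number $q(n)$ of equivalence classes is finite. Let $q_2(n)$, $q^+(n)$ and $q_2^+(n)$ be the number of those classes whose members $f$ satisfy, respectively: $2\mid b$; all roots of $f$ are real; both $2\mid b$ and all roots of $f$ are real (these conditions depend only on the class). Then for every nonzero integer $n$, $$q_2^+(4n)=q(n)\qquad\text{and}\qquad q_2(4n)=2\,q^+(n).$$ -/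

import Mathlib

open Polynomial

/-- Two integer polynomials are translation equivalent if one is obtained from the other by a
substitution `x ↦ x + t` with `t` an integer. -/
def translationSetoid : Setoid ℤ[X] where
  r f g := ∃ t : ℤ, g = f.comp (X + C t)
  iseqv :=
    { refl := fun f => ⟨0, by simp⟩
      symm := by
        rintro f g ⟨t, rfl⟩
        refine ⟨-t, ?_⟩
        rw [comp_assoc]
        simp
      trans := by
        rintro f g h ⟨t, rfl⟩ ⟨s, rfl⟩
        refine ⟨s + t, ?_⟩
        rw [comp_assoc]
        simp [add_assoc] }

/-- The superdiscriminant `I(f) = a (b² - 4 a c)` of `f = a x² + b x + c`. -/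
def superdisc (f : ℤ[X]) : ℤ :=
  f.coeff 2 * (f.coeff 1 ^ 2 - 4 * f.coeff 2 * f.coeff 0)

/-- The integer quadratic polynomials `f = a x² + b x + c` (`a ≠ 0`) with `I(f) = n`. -/
def quadratics (n : ℤ) : Set ℤ[X] :=
  {f | f.natDegree = 2 ∧ superdisc f = n}

/-- All complex roots of `f` are real. -/
def RealRooted (f : ℤ[X]) : Prop :=
  ∀ z : ℂ, aeval z f = 0 → z.im = 0

/-- The set of translation classes that are represented by an element of `S`. -/
def translationClasses (S : Set ℤ[X]) : Set (Quotient translationSetoid) :=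
  (Quotient.mk translationSetoid) '' S

/-- `q(n)`: the number of integer quadratics with `I(f) = n`, up to translation. -/
noncomputable def q (n : ℤ) : ℕ :=
  (translationClasses (quadratics n)).ncard

/-- `q₂(n)`: those with even middle coefficient. -/
noncomputable def qTwo (n : ℤ) : ℕ :=
  (translationClasses {f ∈ quadratics n | 2 ∣ f.coeff 1}).ncard

/-- `q⁺(n)`: those with real roots. -/
noncomputable def qPlus (n : ℤ) : ℕ :=
  (translationClasses {f ∈ quadratics n | RealRooted f}).ncard

/-- `q₂⁺(n)`: those with even middle coefficient and real roots. -/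
noncomputable def qTwoPlus (n : ℤ) : ℕ :=
  (translationClasses {f ∈ quadratics n | 2 ∣ f.coeff 1 ∧ RealRooted f}).ncard

/-! A class with leading coefficient a and discriminant D, where a D = n, amounts to a residue b mod
2a with b² ≡ D mod 4a. For I = 4n and b = 2β the discriminant is 4D with a D = n, and the class
amounts to a residue β mod a with β² ≡ D mod a. Real roots mean D > 0. With r(a, D) = `sqrtCount a
D`, both claims become identities between sums of r(|n|/D, ±D) and r(4|n|/D, ±D) over the positive
divisors D of n: `sum_sqrtCount_reflection`.

The count r is multiplicative in the modulus. At an odd prime p, `exists_local_weights` evaluates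
the sum of r(p^k, p^l v) g(l) over k + l = m, for g depending on the parity of l, as (A + B (v/p))
g(0) + B g(1). That the same B occurs twice is the crux: extracting odd primes one by one writes a
divisor sum as a sum of Jacobi symbols (c | d) over a multiset of coprime odd pairs that is
invariant under swapping (`exists_symmetric_weights`), each weighted by a factor at 2.

Swapping the pairs and applying quadratic reciprocity matches the two sides up to an identity at 2
(`twoAdicSum_reflection`). Its sides obey the same recursion from m to m + 4, so it reduces to
residues mod 8. -/

open scoped NumberTheorySymbols

/-! ### Square roots modulo a: multiplicativity and scaling -/

/-- The number of square roots of `D` modulo `a`. -/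
def sqrtCount (a : ℕ) (D : ℤ) : ℕ :=
  Nat.count (fun b : ℕ => (a : ℤ) ∣ (b : ℤ) ^ 2 - D) a

lemma sqrtCount_eq_natCard {a : ℕ} (ha : a ≠ 0) (D : ℤ) :
    sqrtCount a D = Nat.card {x : ZMod a // x ^ 2 = (D : ZMod a)} := by
  have : NeZero a := ⟨ha⟩
  rw [sqrtCount, Nat.count_eq_card_filter_range, Nat.card_eq_fintype_card, Fintype.card_subtype]
  have key : ∀ b : ℕ, ((a : ℤ) ∣ (b : ℤ) ^ 2 - D) ↔ ((b : ZMod a) ^ 2 = (D : ZMod a)) := by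
    intro b
    rw [← ZMod.intCast_zmod_eq_zero_iff_dvd]
    push_cast
    exact sub_eq_zero
  refine Finset.card_bij' (fun b _ => (b : ZMod a)) (fun x _ => x.val) ?_ ?_ ?_ ?_
  · intro b hb
    simpa [key] using (Finset.mem_filter.1 hb).2
  · intro x hx
    simp only [Finset.mem_filter, Finset.mem_range, key, ZMod.natCast_val, ZMod.cast_id',
      id_eq, ZMod.val_lt, true_and]
    simpa using hx
  · intro b hb
    exact ZMod.val_cast_of_lt (Finset.mem_range.1 (Finset.mem_filter.1 hb).1)
  · intro x _
    simp

lemma sqrtCount_congr {a : ℕ} {D E : ℤ} (h : (a : ℤ) ∣ D - E) : sqrtCount a D = sqrtCount a E := by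
  unfold sqrtCount
  congr 1
  funext b
  rw [eq_iff_iff, show (b : ℤ) ^ 2 - E = ((b : ℤ) ^ 2 - D) + (D - E) by ring, dvd_add_left h]

@[simp] lemma sqrtCount_one (D : ℤ) : sqrtCount 1 D = 1 := by
  simp [sqrtCount, Nat.count_succ]

lemma sqrtCount_mul {a b : ℕ} (ha : a ≠ 0) (hb : b ≠ 0) (h : a.Coprime b) (D : ℤ) :
    sqrtCount (a * b) D = sqrtCount a D * sqrtCount b D := by
  rw [sqrtCount_eq_natCard (mul_ne_zero ha hb), sqrtCount_eq_natCard ha, sqrtCount_eq_natCard hb,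
    ← Nat.card_prod]
  let e := ZMod.chineseRemainder h
  have he : ∀ x : ZMod (a * b), x ^ 2 = (D : ZMod (a * b)) ↔
      (e x).1 ^ 2 = (D : ZMod a) ∧ (e x).2 ^ 2 = (D : ZMod b) := by
    intro x
    rw [← e.injective.eq_iff, map_pow, map_intCast, Prod.ext_iff]
    simp
  refine Nat.card_congr ⟨fun x => (⟨(e x.1).1, ((he x.1).1 x.2).1⟩, ⟨(e x.1).2, ((he x.1).1 x.2).2⟩),
    fun y => ⟨e.symm (y.1.1, y.2.1), ?_⟩, ?_, ?_⟩
  · rw [he]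
    simpa using ⟨y.1.2, y.2.2⟩
  · intro x
    simp
  · intro y
    simp

lemma sqrtCount_unit_sq_mul {a : ℕ} (ha : a ≠ 0) {u : ℤ} (hu : IsCoprime u (a : ℤ)) (D : ℤ) :
    sqrtCount a (u ^ 2 * D) = sqrtCount a D := by
  rw [sqrtCount_eq_natCard ha, sqrtCount_eq_natCard ha]
  obtain ⟨v, w, hvw⟩ := hu
  have h : (v : ZMod a) * (u : ZMod a) = 1 := by
    have := congrArg (Int.cast : ℤ → ZMod a) hvw
    simpa using this
  refine Nat.card_congr ⟨fun x => ⟨v * x.1, ?_⟩, fun x => ⟨u * x.1, ?_⟩, ?_, ?_⟩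
  · rw [mul_pow, x.2]
    push_cast
    linear_combination ((v : ZMod a) * u + 1) * D * h
  · rw [mul_pow, x.2]
    push_cast
    ring
  · intro x
    ext
    simp only
    linear_combination (x : ZMod a) * h
  · intro x
    ext
    simp only
    linear_combination (x : ZMod a) * h

lemma count_mul_of_periodic {P : ℕ → Prop} [DecidablePred P] {a : ℕ}
    (hP : ∀ b, P (a + b) ↔ P b) (m : ℕ) : Nat.count P (m * a) = m * Nat.count P a := by
  induction m with
  | zero => simp
  | succ m ih =>
    rw [add_mul, one_mul, add_comm, Nat.count_add]
    simp only [hP]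
    rw [ih]
    ring

/-- A root b must be p c with c² ≡ D mod a. Here c ranges mod p a while the condition has period a,
whence the factor p. -/
lemma sqrtCount_sq_mul {p : ℕ} (hp : p.Prime) (a : ℕ) (D : ℤ) :
    sqrtCount (p ^ 2 * a) ((p : ℤ) ^ 2 * D) = p * sqrtCount a D := by
  have hp0 : (p : ℤ) ^ 2 ≠ 0 := by exact_mod_cast pow_ne_zero 2 hp.ne_zero
  unfold sqrtCount
  rw [← count_mul_of_periodic, Nat.count_eq_card_filter_range, Nat.count_eq_card_filter_range]
  · symm
    refine Finset.card_bij (fun b _ => p * b) ?_ ?_ ?_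
    · intro b hb
      simp only [Finset.mem_filter, Finset.mem_range] at hb ⊢
      refine ⟨?_, ?_⟩
      · rw [pow_two, mul_assoc]
        exact Nat.mul_lt_mul_of_pos_left hb.1 hp.pos
      · push_cast
        rw [mul_pow, ← mul_sub]
        exact mul_dvd_mul_left _ hb.2
    · intro b _ c _ h
      exact Nat.eq_of_mul_eq_mul_left hp.pos h
    · intro b hb
      simp only [Finset.mem_filter, Finset.mem_range] at hb
      have h1 : (p : ℤ) ∣ (b : ℤ) := by
        have h2 : (p : ℤ) ∣ (b : ℤ) ^ 2 - p ^ 2 * D := by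
          refine dvd_trans ⟨p * a, ?_⟩ hb.2
          push_cast
          ring
        have h3 : (p : ℤ) ∣ (b : ℤ) ^ 2 :=
          (dvd_sub_left (Dvd.intro _ (by ring : (p : ℤ) * (p * D) = p ^ 2 * D))).1 h2
        exact (Nat.prime_iff_prime_int.1 hp).dvd_of_dvd_pow h3
      obtain ⟨c, rfl⟩ := Int.natCast_dvd_natCast.1 h1
      refine ⟨c, ?_, rfl⟩
      simp only [Finset.mem_filter, Finset.mem_range]
      refine ⟨?_, ?_⟩
      · have := hb.1
        rw [pow_two, mul_assoc] at this
        exact Nat.lt_of_mul_lt_mul_left this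
      · have := hb.2
        push_cast at this
        rw [mul_pow, ← mul_sub] at this
        exact (mul_dvd_mul_iff_left hp0).1 this
  · intro b
    push_cast
    rw [show ((a : ℤ) + b) ^ 2 - D = (b ^ 2 - D) + a * (a + 2 * b) by ring,
      dvd_add_left (dvd_mul_right _ _)]

/-! ### Square roots modulo prime powers -/

lemma sqrtCount_eq_zero {a : ℕ} {D : ℤ} (h : ∀ b : ℤ, ¬ (a : ℤ) ∣ b ^ 2 - D) :
    sqrtCount a D = 0 := by
  rw [sqrtCount, Nat.count_eq_card_filter_range, Finset.card_eq_zero,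
    Finset.filter_eq_empty_iff]
  exact fun b _ => h b

lemma sqrtCount_prime_dvd {p : ℕ} (hp : p.Prime) {D : ℤ} (h : (p : ℤ) ∣ D) :
    sqrtCount p D = 1 := by
  rw [sqrtCount, Nat.count_eq_card_filter_range, Finset.card_eq_one]
  refine ⟨0, ?_⟩
  ext b
  simp only [Finset.mem_filter, Finset.mem_range, Finset.mem_singleton]
  rw [dvd_sub_left h]
  constructor
  · rintro ⟨h1, h2⟩
    have h3 := (Nat.prime_iff_prime_int.1 hp).dvd_of_dvd_pow h2
    exact Nat.eq_zero_of_dvd_of_lt (Int.natCast_dvd_natCast.1 h3) h1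
  · rintro rfl
    exact ⟨hp.pos, by simp⟩

/-- A root would be divisible by p, so its square by p², while p v is not. -/
lemma sqrtCount_prime_pow_of_exact_dvd {p : ℕ} (hp : p.Prime) (k : ℕ) {v : ℤ}
    (hv : ¬ (p : ℤ) ∣ v) : sqrtCount (p ^ (k + 2)) (p * v) = 0 := by
  have hp' := Nat.prime_iff_prime_int.1 hp
  refine sqrtCount_eq_zero fun b hb => hv ?_
  have h2 : (p : ℤ) ^ 2 ∣ b ^ 2 - p * v := by
    refine dvd_trans ?_ hb
    push_cast
    exact pow_dvd_pow _ (by omega)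
  have h3 : (p : ℤ) ∣ b ^ 2 :=
    (dvd_sub_left (dvd_mul_right (p : ℤ) v)).1 (dvd_trans (dvd_pow_self _ two_ne_zero) h2)
  have h4 : (p : ℤ) ^ 2 ∣ b ^ 2 := pow_dvd_pow_of_dvd (hp'.dvd_of_dvd_pow h3) 2
  rw [dvd_sub_right h4, pow_two] at h2
  exact (mul_dvd_mul_iff_left hp'.ne_zero).1 h2

lemma sqrtCount_eq_of_sq {a : ℕ} (ha : a ≠ 0) {u D : ℤ} (hu : IsCoprime u (a : ℤ))
    (h : (a : ℤ) ∣ u ^ 2 - D) : sqrtCount a D = sqrtCount a 1 := by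
  rw [← sqrtCount_unit_sq_mul ha hu 1, mul_one]
  exact (sqrtCount_congr h).symm

/-- Hensel lifting: the derivative 2u is a unit mod p. -/
lemma exists_sq_modEq_odd_prime_pow {p : ℕ} (hp : p.Prime) (hp2 : p ≠ 2) {D : ℤ}
    (hD : ¬ (p : ℤ) ∣ D) {u₀ : ℤ} (h₀ : (p : ℤ) ∣ u₀ ^ 2 - D) (k : ℕ) :
    ∃ u : ℤ, (p : ℤ) ^ (k + 1) ∣ u ^ 2 - D := by
  have hp' := Nat.prime_iff_prime_int.1 hp
  induction k with
  | zero => exact ⟨u₀, by simpa using h₀⟩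
  | succ k ih =>
    obtain ⟨u, t, ht⟩ := ih
    have hu : ¬ (p : ℤ) ∣ 2 * u := by
      intro h
      rcases hp'.dvd_or_dvd h with h | h
      · exact hp2 ((Nat.prime_dvd_prime_iff_eq hp Nat.prime_two).1 (by exact_mod_cast h))
      · apply hD
        have h1 : (p : ℤ) ∣ u ^ 2 - D := ht ▸ dvd_mul_of_dvd_left (dvd_pow_self _ (by omega)) _
        exact (dvd_sub_right (dvd_pow h two_ne_zero)).1 h1
    obtain ⟨x, y, hxy⟩ := (hp'.coprime_iff_not_dvd.2 hu).symm
    -- Since x inverts 2u mod p, the correction -t x cancels the error t to first order.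
    refine ⟨u + p ^ (k + 1) * (-t * x), t * y + p ^ k * (t * x) ^ 2, ?_⟩
    have : (u + (p : ℤ) ^ (k + 1) * (-t * x)) ^ 2 - D =
        (u ^ 2 - D) - p ^ (k + 1) * t * (x * (2 * u)) + p ^ (2 * k + 2) * (t * x) ^ 2 := by ring
    rw [this, ht]
    linear_combination (-(p : ℤ) ^ (k + 1) * t) * hxy

/-- An odd p divides at most one of b - 1 and b + 1, so the whole prime power divides one of them.
-/
lemma sqrtCount_odd_prime_pow_one {p : ℕ} (hp : p.Prime) (hp2 : p ≠ 2) (k : ℕ) :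
    sqrtCount (p ^ (k + 1)) 1 = 2 := by
  have hp' := Nat.prime_iff_prime_int.1 hp
  have h3 : 3 ≤ p ^ (k + 1) := by
    have : 3 ≤ p := by have := hp.two_le; omega
    calc 3 ≤ p := this
      _ ≤ p ^ (k + 1) := Nat.le_self_pow (by omega) p
  rw [sqrtCount, Nat.count_eq_card_filter_range, Finset.card_eq_two]
  refine ⟨1, p ^ (k + 1) - 1, by omega, ?_⟩
  ext b
  simp only [Finset.mem_filter, Finset.mem_range, Finset.mem_insert, Finset.mem_singleton]
  constructor
  · rintro ⟨h1, h2⟩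
    have hb : ((p ^ (k + 1) : ℕ) : ℤ) ∣ (b - 1) * (b + 1) := by convert h2 using 1; ring
    push_cast at hb
    by_cases hd : (p : ℤ) ∣ b - 1
    · have hc : IsCoprime ((p : ℤ) ^ (k + 1)) (b + 1) := by
        refine IsCoprime.pow_left (hp'.coprime_iff_not_dvd.2 fun h => hp2 ?_)
        have := dvd_sub h hd
        rw [show (b : ℤ) + 1 - (b - 1) = 2 by ring] at this
        exact (Nat.prime_dvd_prime_iff_eq hp Nat.prime_two).1 (by exact_mod_cast this)
      have h4 := hc.dvd_of_dvd_mul_right hb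
      left
      have h5 : (b : ℤ) - 1 = 0 := by
        rcases Nat.eq_zero_or_pos b with rfl | hb0
        · exfalso
          have := Int.le_of_dvd (by norm_num) ((dvd_neg).2 h4)
          have h6 : (3 : ℤ) ≤ (p : ℤ) ^ (k + 1) := by exact_mod_cast h3
          norm_num at this
          linarith
        · refine Int.eq_zero_of_dvd_of_nonneg_of_lt (by omega) ?_ h4
          have : (b : ℤ) < (p : ℤ) ^ (k + 1) := by exact_mod_cast h1
          linarith
      omega
    · have hc : IsCoprime ((p : ℤ) ^ (k + 1)) (b - 1) :=
        IsCoprime.pow_left (hp'.coprime_iff_not_dvd.2 hd)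
      have h4 := hc.dvd_of_dvd_mul_left hb
      right
      have h5 : p ^ (k + 1) ∣ b + 1 := by exact_mod_cast h4
      have := Nat.le_of_dvd (by omega) h5
      omega
  · rintro (rfl | rfl)
    · exact ⟨by omega, by simp⟩
    · refine ⟨by omega, ?_⟩
      rw [Nat.cast_sub (by omega)]
      exact ⟨(p ^ (k + 1) : ℕ) - 2, by push_cast; ring⟩

lemma sqrtCount_odd_prime_pow {p : ℕ} [hp : Fact p.Prime] (hp2 : p ≠ 2) (k : ℕ) {D : ℤ}
    (hD : ¬ (p : ℤ) ∣ D) : (sqrtCount (p ^ (k + 1)) D : ℤ) = 1 + legendreSym p D := by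
  have hp' := Nat.prime_iff_prime_int.1 hp.out
  have hD0 : (D : ZMod p) ≠ 0 := by rwa [Ne, ZMod.intCast_zmod_eq_zero_iff_dvd]
  rcases legendreSym.eq_one_or_neg_one p hD0 with h | h
  · obtain ⟨x, hx⟩ := (legendreSym.eq_one_iff p hD0).1 h
    have h₀ : (p : ℤ) ∣ (x.val : ℤ) ^ 2 - D := by
      rw [← ZMod.intCast_zmod_eq_zero_iff_dvd]
      simp [hx, pow_two]
    obtain ⟨u, hu⟩ := exists_sq_modEq_odd_prime_pow hp.out hp2 hD h₀ k
    have hpu : ¬ (p : ℤ) ∣ u := fun h1 => hD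
      ((dvd_sub_right (dvd_pow h1 two_ne_zero)).1 (dvd_trans (dvd_pow_self _ (by omega)) hu))
    rw [sqrtCount_eq_of_sq (u := u) (pow_ne_zero _ hp.out.ne_zero) ?_ (by exact_mod_cast hu),
      sqrtCount_odd_prime_pow_one hp.out hp2, h]
    · norm_num
    · push_cast
      exact (IsCoprime.pow_left (hp'.coprime_iff_not_dvd.2 hpu)).symm
  · rw [sqrtCount_eq_zero, h]
    · norm_num
    · intro b hb
      have hs : IsSquare (D : ZMod p) := by
        refine ⟨(b : ZMod p), ?_⟩
        have h1 : (p : ℤ) ∣ b ^ 2 - D := by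
          refine dvd_trans ?_ hb
          push_cast
          exact dvd_pow_self _ (by omega)
        rw [← ZMod.intCast_zmod_eq_zero_iff_dvd] at h1
        push_cast at h1
        rw [← pow_two, eq_comm]
        exact sub_eq_zero.1 h1
      rw [(legendreSym.eq_one_iff p hD0).2 hs] at h
      norm_num at h

lemma sqrtCount_two (D : ℤ) : sqrtCount 2 D = 1 := by
  rcases Int.emod_two_eq_zero_or_one D with h | h
  · exact sqrtCount_prime_dvd Nat.prime_two (Int.dvd_of_emod_eq_zero h)
  · rw [sqrtCount_congr (E := 1) (by push_cast; omega)]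
    decide

lemma sqrtCount_four {D : ℤ} (hD : D % 2 = 1) :
    sqrtCount 4 D = if D % 4 = 1 then 2 else 0 := by
  split_ifs with h
  · rw [sqrtCount_congr (E := 1) (by push_cast; omega)]
    decide
  · rw [sqrtCount_congr (E := 3) (by push_cast; omega)]
    decide

/-- Adding 2^(k+2) t to the odd number u changes u² by 2^(k+3) u t modulo 2^(k+4), which cancels the
error 2^(k+3) t. -/
lemma exists_sq_modEq_two_pow {D : ℤ} (hD : D % 8 = 1) (k : ℕ) :
    ∃ u : ℤ, (2 : ℤ) ^ (k + 3) ∣ u ^ 2 - D := by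
  induction k with
  | zero => exact ⟨1, by norm_num; omega⟩
  | succ k ih =>
    obtain ⟨u, t, ht⟩ := ih
    have hu : u % 2 = 1 := by
      by_contra h
      obtain ⟨w, rfl⟩ : (2 : ℤ) ∣ u := by omega
      have : (2 * w) ^ 2 - D = 2 * (2 ^ (k + 2) * t) := by rw [ht]; ring
      have h2 : D = 2 * (2 * w ^ 2 - 2 ^ (k + 2) * t) := by linarith
      omega
    obtain ⟨w, hw⟩ : ∃ w, u = 2 * w + 1 := ⟨u / 2, by omega⟩
    refine ⟨u + 2 ^ (k + 2) * t, t * (w + 1) + 2 ^ k * t ^ 2, ?_⟩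
    have : (u + 2 ^ (k + 2) * t) ^ 2 - D =
      (u ^ 2 - D) + 2 ^ (k + 3) * (u * t) + 2 ^ (2 * k + 4) * t ^ 2 := by ring
    rw [this, ht, hw]
    ring

/-- For b = 2w + 1, b² - 1 = 4w(w + 1) with w and w + 1 coprime, so 2^(k+1) divides one of them.
Each alternative gives two residues b. -/
lemma sqrtCount_two_pow_one (k : ℕ) : sqrtCount (2 ^ (k + 3)) 1 = 4 := by
  have hq0 : 0 < 2 ^ k := by positivity
  have hdvd : ∀ b : ℕ, ((2 ^ (k + 3) : ℕ) : ℤ) ∣ (b : ℤ) ^ 2 - 1 ↔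
      ∃ w, b = 2 * w + 1 ∧ 2 ^ k * 2 ∣ w * (w + 1) := by
    intro b
    push_cast
    have hcast : ∀ w : ℕ, (2 : ℤ) ^ (k + 3) ∣ ((2 * w + 1 : ℕ) : ℤ) ^ 2 - 1 ↔
        2 ^ k * 2 ∣ w * (w + 1) := by
      intro w
      rw [← Int.natCast_dvd_natCast,
        ← mul_dvd_mul_iff_left (a := (4 : ℤ)) (c := ((w * (w + 1) : ℕ) : ℤ)) (by norm_num)]
      push_cast
      rw [show (4 : ℤ) * (2 ^ k * 2) = 2 ^ (k + 3) by ring,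
        show (4 : ℤ) * (w * (w + 1)) = (2 * w + 1) ^ 2 - 1 by ring]
    constructor
    · intro h2
      have hodd : b % 2 = 1 := by
        by_contra h
        obtain ⟨w, rfl⟩ : 2 ∣ b := by omega
        have h3 : (2 : ℤ) ∣ ((2 * w : ℕ) : ℤ) ^ 2 - 1 := dvd_trans (dvd_pow_self _ (by omega)) h2
        push_cast at h3
        rw [show (2 * (w : ℤ)) ^ 2 - 1 = 2 * (2 * w ^ 2) - 1 by ring] at h3
        omega
      obtain ⟨w, rfl⟩ : ∃ w, b = 2 * w + 1 := ⟨b / 2, by omega⟩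
      exact ⟨w, rfl, (hcast w).1 h2⟩
    · rintro ⟨w, rfl, h⟩
      exact (hcast w).2 h
  have hset : (Finset.range (2 ^ (k + 3))).filter
      (fun b : ℕ => ((2 ^ (k + 3) : ℕ) : ℤ) ∣ (b : ℤ) ^ 2 - 1) =
      ({1, 4 * 2 ^ k - 1, 4 * 2 ^ k + 1, 8 * 2 ^ k - 1} : Finset ℕ) := by
    ext b
    simp only [Finset.mem_filter, Finset.mem_range, Finset.mem_insert, Finset.mem_singleton, hdvd]
    rw [show 2 ^ (k + 3) = 8 * 2 ^ k by ring]
    generalize hq : 2 ^ k = q at *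
    have hcop : ∀ x : ℕ, x % 2 = 1 → Nat.Coprime (q * 2) x := by
      intro x hx
      rw [← hq, ← pow_succ]
      exact Nat.Coprime.pow_left _ (Nat.coprime_two_left.2 (Nat.odd_iff.2 hx))
    constructor
    · rintro ⟨h1, w, rfl, h⟩
      rcases Nat.mod_two_eq_zero_or_one w with hw | hw
      · obtain ⟨j, rfl⟩ := (hcop (w + 1) (by omega)).dvd_of_dvd_mul_right h
        have hj : j < 2 := by
          by_contra hj
          have := Nat.mul_le_mul_left q (not_lt.1 hj)
          have e : q * 2 * j = 2 * (q * j) := by ring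
          omega
        interval_cases j <;> omega
      · obtain ⟨j, hj'⟩ := (hcop w hw).dvd_of_dvd_mul_left h
        have hj : j < 3 := by
          by_contra hj
          have := Nat.mul_le_mul_left q (not_lt.1 hj)
          have e : q * 2 * j = 2 * (q * j) := by ring
          omega
        interval_cases j <;> omega
    · rintro (rfl | rfl | rfl | rfl)
      · exact ⟨by omega, 0, rfl, by simp⟩
      · exact ⟨by omega, 2 * q - 1, by omega, Dvd.dvd.mul_left ⟨1, by omega⟩ _⟩
      · exact ⟨by omega, 2 * q, by ring, Dvd.dvd.mul_right ⟨1, by ring⟩ _⟩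
      · exact ⟨by omega, 4 * q - 1, by omega, Dvd.dvd.mul_left ⟨2, by omega⟩ _⟩
  rw [sqrtCount, Nat.count_eq_card_filter_range, hset, Finset.card_insert_of_notMem, Finset.card_insert_of_notMem,
    Finset.card_insert_of_notMem, Finset.card_singleton] <;>
  simp only [Finset.mem_insert, Finset.mem_singleton] <;> omega

lemma sqrtCount_two_pow (k : ℕ) {D : ℤ} (hD : D % 2 = 1) :
    sqrtCount (2 ^ (k + 3)) D = if D % 8 = 1 then 4 else 0 := by
  split_ifs with h
  · obtain ⟨u, hu⟩ := exists_sq_modEq_two_pow h k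
    rw [sqrtCount_eq_of_sq (u := u) (by positivity) ?_ (by exact_mod_cast hu),
      sqrtCount_two_pow_one]
    push_cast
    refine IsCoprime.pow_right ((Int.prime_two.coprime_iff_not_dvd.2 fun h1 => ?_).symm)
    have h2 := (dvd_sub_right (dvd_pow h1 two_ne_zero)).1
      (dvd_trans (dvd_pow_self _ (by omega)) hu)
    omega
  · refine sqrtCount_eq_zero fun b hb => h ?_
    have h8 : (8 : ℤ) ∣ b ^ 2 - D := by
      refine dvd_trans ⟨2 ^ k, ?_⟩ hb
      push_cast
      ring
    have : b % 8 = 0 ∨ b % 8 = 1 ∨ b % 8 = 2 ∨ b % 8 = 3 ∨ b % 8 = 4 ∨ b % 8 = 5 ∨ b % 8 = 6 ∨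
      b % 8 = 7 := by omega
    have hb2 : b ^ 2 % 8 = 0 ∨ b ^ 2 % 8 = 1 ∨ b ^ 2 % 8 = 4 := by
      rcases this with h | h | h | h | h | h | h | h <;> simp [pow_two, Int.mul_emod, h]
    omega

/-! ### Divisor sums and the local factor at an odd prime -/

open Finset in
lemma sum_divisors_prime_pow_mul {R : Type*} [AddCommMonoid R] {p M : ℕ} (hp : p.Prime)
    (hM : M ≠ 0) (hpM : ¬ p ∣ M) (m : ℕ) (f : ℕ → ℕ → R) :
    ∑ D ∈ (p ^ m * M).divisors, f (p ^ m * M / D) D =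
      ∑ kl ∈ antidiagonal m, ∑ D ∈ M.divisors, f (p ^ kl.1 * (M / D)) (p ^ kl.2 * D) := by
  rw [← sum_product']
  symm
  refine sum_bij (fun x _ => p ^ x.1.2 * x.2) ?_ ?_ ?_ ?_
  · rintro ⟨⟨k, l⟩, D⟩ h
    simp only [mem_product, HasAntidiagonal.mem_antidiagonal, Nat.mem_divisors] at h ⊢
    exact ⟨mul_dvd_mul (pow_dvd_pow _ (by omega)) h.2.1,
      mul_ne_zero (pow_ne_zero _ hp.ne_zero) hM⟩
  · rintro ⟨⟨k, l⟩, D⟩ h ⟨⟨k', l'⟩, D'⟩ h' heq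
    simp only [mem_product, HasAntidiagonal.mem_antidiagonal, Nat.mem_divisors] at h h' heq
    have hD : ¬ p ∣ D := fun hd => hpM (hd.trans h.2.1)
    have hD' : ¬ p ∣ D' := fun hd => hpM (hd.trans h'.2.1)
    have hl : l = l' := by
      rcases lt_trichotomy l l' with hlt | hl | hlt
      · exfalso
        obtain ⟨j, rfl⟩ := Nat.exists_eq_add_of_lt hlt
        rw [show p ^ (l + j + 1) * D' = p ^ l * (p * (p ^ j * D')) by ring] at heq
        exact hD ⟨_, Nat.eq_of_mul_eq_mul_left (pow_pos hp.pos l) heq⟩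
      · exact hl
      · exfalso
        obtain ⟨j, rfl⟩ := Nat.exists_eq_add_of_lt hlt
        rw [show p ^ (l' + j + 1) * D = p ^ l' * (p * (p ^ j * D)) by ring] at heq
        exact hD' ⟨_, Nat.eq_of_mul_eq_mul_left (pow_pos hp.pos l') heq.symm⟩
    subst hl
    have hk : k = k' := by omega
    subst hk
    rw [Nat.eq_of_mul_eq_mul_left (pow_pos hp.pos l) heq]
  · intro E hE
    obtain ⟨a, b, ha, hb, rfl⟩ := (Nat.dvd_mul).1 (Nat.dvd_of_mem_divisors hE)
    obtain ⟨l, hl, rfl⟩ := (Nat.dvd_prime_pow hp).1 ha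
    exact ⟨((m - l, l), b), by simp [hb, hM, hl], rfl⟩
  · rintro ⟨⟨k, l⟩, D⟩ h
    simp only [mem_product, HasAntidiagonal.mem_antidiagonal, Nat.mem_divisors] at h ⊢
    congr 1
    obtain ⟨E, rfl⟩ := h.2.1
    have hD : 0 < D := Nat.pos_of_ne_zero (by rintro rfl; simp at hM)
    rw [Nat.mul_div_cancel_left _ hD, ← h.1, show p ^ (k + l) * (D * E) = p ^ l * D * (p ^ k * E) by ring,
      Nat.mul_div_cancel_left _ (mul_pos (pow_pos hp.pos l) hD)]

open Finset in
/-- Four consecutive boundary terms of a sum over an antidiagonal. -/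
lemma sum_antidiagonal_add_four {R : Type*} [AddCommMonoid R] (m : ℕ) (f : ℕ → ℕ → R) :
    ∑ kl ∈ antidiagonal (m + 4), f kl.1 kl.2 =
      f 0 (m + 4) + f 1 (m + 3) + f (m + 4) 0 + f (m + 3) 1 +
        ∑ kl ∈ antidiagonal m, f (kl.1 + 2) (kl.2 + 2) := by
  rw [Nat.sum_antidiagonal_succ, Nat.sum_antidiagonal_succ, Nat.sum_antidiagonal_succ',
    Nat.sum_antidiagonal_succ']
  simp only [add_assoc, zero_add]
  rfl

/-- Makes the interior terms of a local sum p times the local sum with m lowered by 4. -/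
lemma sqrtCount_prime_pow_add_two {p : ℕ} (hp : p.Prime) (k l : ℕ) (v : ℤ) :
    sqrtCount (p ^ (k + 2)) ((p : ℤ) ^ (l + 2) * v) = p * sqrtCount (p ^ k) ((p : ℤ) ^ l * v) := by
  rw [← sqrtCount_sq_mul hp]
  congr 1 <;> ring

open Finset in
/-- The local factor at an odd prime, as a function of the parity-dependent weight `g`. -/
lemma exists_local_weights {p : ℕ} [hp : Fact p.Prime] (hp2 : p ≠ 2) (m : ℕ) :
    ∃ A B : ℕ, ∀ (v : ℤ) (g : ℕ → ℤ), ¬ (p : ℤ) ∣ v → (∀ l, g (l + 2) = g l) →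
      ∑ kl ∈ antidiagonal m, (sqrtCount (p ^ kl.1) ((p : ℤ) ^ kl.2 * v) : ℤ) * g kl.2 =
        (A + B * legendreSym p v) * g 0 + B * g 1 := by
  have hr : ∀ (k : ℕ) {v : ℤ}, ¬ (p : ℤ) ∣ v →
      (sqrtCount (p ^ (k + 1)) v : ℤ) = 1 + legendreSym p v :=
    fun k v hv => sqrtCount_odd_prime_pow hp2 k hv
  have hr1 : ∀ v : ℤ, ¬ (p : ℤ) ∣ v → (sqrtCount p v : ℤ) = 1 + legendreSym p v :=
    fun v hv => by simpa using hr 0 hv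
  have hd : ∀ (l : ℕ) (v : ℤ), sqrtCount p ((p : ℤ) ^ (l + 1) * v) = 1 := fun l v =>
    sqrtCount_prime_dvd hp.out (dvd_mul_of_dvd_left (dvd_pow_self _ (by omega)) _)
  have h0 : ∀ (k : ℕ) {v : ℤ}, ¬ (p : ℤ) ∣ v → sqrtCount (p ^ (k + 2)) (p * v) = 0 :=
    fun k v hv => sqrtCount_prime_pow_of_exact_dvd hp.out k hv
  have hg : ∀ (g : ℕ → ℤ), (∀ l, g (l + 2) = g l) → ∀ l, g l + g (l + 1) = g 0 + g 1 := by
    intro g hg l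
    induction l with
    | zero => rfl
    | succ l ih => rw [← ih, hg l]; ring
  induction m using Nat.strong_induction_on with
  | _ m ih =>
  match m with
  | 0 => exact ⟨1, 0, fun v g _ _ => by simp⟩
  | 1 =>
    refine ⟨1, 1, fun v g hv hgp => ?_⟩
    simp only [Nat.sum_antidiagonal_succ, Nat.antidiagonal_zero, sum_singleton]
    simp [hr1 v hv]
    ring
  | 2 =>
    refine ⟨2, 1, fun v g hv hgp => ?_⟩
    have := hr 1 hv
    have h1 := hd 0 v
    simp only [Nat.sum_antidiagonal_succ, Nat.antidiagonal_zero, sum_singleton]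
    simp_all
    ring
  | 3 =>
    refine ⟨2, 1, fun v g hv hgp => ?_⟩
    have := hr 2 hv
    have h1 := hd 1 v
    have h2 := h0 0 hv
    simp only [Nat.sum_antidiagonal_succ, Nat.antidiagonal_zero, sum_singleton]
    simp_all
    ring
  | m + 4 =>
    obtain ⟨A, B, h⟩ := ih m (by omega)
    -- The interior gives p A and p B. The boundary terms k = 0, 1 give g(m+4) + g(m+3) = g(0) +
    -- g(1), the term l = 0 gives (1 + (v/p)) g(0), and the term l = 1 vanishes.
    refine ⟨p * A + 2, p * B + 1, fun v g hv hgp => ?_⟩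
    rw [sum_antidiagonal_add_four m
      (fun k l => (sqrtCount (p ^ k) ((p : ℤ) ^ l * v) : ℤ) * g l)]
    simp only [sqrtCount_prime_pow_add_two hp.out, hgp, pow_zero, pow_one, sqrtCount_one, one_mul,
      hd, Nat.cast_mul, mul_assoc, ← mul_sum]
    have e1 : sqrtCount (p ^ (m + 3)) (p * v) = 0 := h0 (m + 1) hv
    rw [h v g hv hgp, hr (m + 3) hv, e1]
    have := hg g hgp m
    push_cast
    linear_combination this

/-! ### Odd part: symmetric sums of Jacobi symbols -/

/-- For odd `N`, weighted sums of the square root counts `sqrtCount (N / D) (h * D)` over the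
divisors `D` of `N` are sums of Jacobi symbols over a symmetric multiset of coprime pairs. -/
lemma exists_symmetric_weights {N : ℕ} (hN : Odd N) :
    ∃ W : Multiset (ℕ × ℕ), W.map Prod.swap = W ∧
      (∀ x ∈ W, x.1.Coprime x.2 ∧ x.1.Coprime 2 ∧ x.2.Coprime 2 ∧
        ∀ p : ℕ, p.Prime → ¬ p ∣ N → ¬ p ∣ x.1 ∧ ¬ p ∣ x.2) ∧
      ∀ (h : ℤ) (φ : ℕ → ℤ), (∀ p : ℕ, p.Prime → p ∣ N → ¬ (p : ℤ) ∣ h) →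
        (∀ p : ℕ, p.Prime → p ∣ N → ∀ x, φ (p ^ 2 * x) = φ x) →
        ∑ D ∈ N.divisors, (sqrtCount (N / D) (h * D) : ℤ) * φ D =
          (W.map fun x => J(h * x.1 | x.2) * φ x.1).sum := by
  induction N using Nat.recOnPrimePow with
  | zero => simp at hN
  | one =>
    refine ⟨{(1, 1)}, by simp, by simp +contextual [Nat.Prime.ne_one], fun h φ _ _ => ?_⟩
    simp
  | prime_pow_mul M p m hp hpM hm ih =>
    have hpN : p ∣ p ^ m * M := Dvd.dvd.mul_right (dvd_pow_self p hm.ne') M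
    have hpodd : Odd p := Odd.of_dvd_nat hN hpN
    have hp2 : p ≠ 2 := by rintro rfl; exact absurd hpodd (by decide)
    have hM : Odd M := Odd.of_dvd_nat hN (dvd_mul_left _ _)
    have hM0 : M ≠ 0 := by rintro rfl; simp at hM
    have : Fact p.Prime := ⟨hp⟩
    obtain ⟨W, hswap, hW, hsum⟩ := ih hM
    obtain ⟨A, B, hAB⟩ := exists_local_weights hp2 m
    -- The term A g(0) keeps a pair, B (v/p) g(0) puts p into the lower entry, and B g(1) puts it
    -- into the upper entry. Equal multiplicities B preserve the symmetry.
    refine ⟨A • W + B • W.map (fun x => (x.1, p * x.2)) + B • W.map (fun x => (p * x.1, x.2)),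
      ?_, ?_, ?_⟩
    · simp only [Multiset.map_add, Multiset.map_nsmul, Multiset.map_map, hswap]
      rw [add_assoc, add_assoc, add_comm (B • _)]
      congr 3
      · nth_rewrite 2 [← hswap]
        rw [Multiset.map_map]
        rfl
      · nth_rewrite 2 [← hswap]
        rw [Multiset.map_map]
        rfl
    · have hp2' : p.Coprime 2 := (Nat.coprime_primes hp Nat.prime_two).2 hp2
      have hmem : ∀ x ∈ W, p.Coprime x.1 ∧ p.Coprime x.2 := fun x hx =>
        ⟨hp.coprime_iff_not_dvd.2 ((hW x hx).2.2.2 p hp hpM).1,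
          hp.coprime_iff_not_dvd.2 ((hW x hx).2.2.2 p hp hpM).2⟩
      have hr : ∀ r : ℕ, r.Prime → ¬ r ∣ p ^ m * M → ¬ r ∣ M ∧ ¬ r ∣ p := fun r _ h =>
        ⟨fun h' => h (h'.mul_left _), fun h' => h (h'.trans hpN)⟩
      intro x hx
      rw [Multiset.mem_add, Multiset.mem_add] at hx
      rcases hx with (hx | hx) | hx
      · have hx := hW x (Multiset.mem_of_mem_nsmul hx)
        exact ⟨hx.1, hx.2.1, hx.2.2.1, fun r hr1 hr2 => hx.2.2.2 r hr1 (hr r hr1 hr2).1⟩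
      · obtain ⟨y, hy, rfl⟩ := Multiset.mem_map.1 (Multiset.mem_of_mem_nsmul hx)
        obtain ⟨h1, h2, h3, h4⟩ := hW y hy
        refine ⟨Nat.Coprime.mul_right (hmem y hy).1.symm h1, h2, Nat.Coprime.mul_left hp2' h3,
          fun r hr1 hr2 => ?_⟩
        obtain ⟨h5, h6⟩ := hr r hr1 hr2
        exact ⟨(h4 r hr1 h5).1, fun h7 => ((Nat.Prime.dvd_mul hr1).1 h7).elim h6 (h4 r hr1 h5).2⟩
      · obtain ⟨y, hy, rfl⟩ := Multiset.mem_map.1 (Multiset.mem_of_mem_nsmul hx)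
        obtain ⟨h1, h2, h3, h4⟩ := hW y hy
        refine ⟨Nat.Coprime.mul_left (hmem y hy).2 h1, Nat.Coprime.mul_left hp2' h2, h3,
          fun r hr1 hr2 => ?_⟩
        obtain ⟨h5, h6⟩ := hr r hr1 hr2
        exact ⟨fun h7 => ((Nat.Prime.dvd_mul hr1).1 h7).elim h6 (h4 r hr1 h5).1, (h4 r hr1 h5).2⟩
    · intro h φ hh hφ
      have hph : ¬ (p : ℤ) ∣ h := hh p hp hpN
      have hp' := Nat.prime_iff_prime_int.1 hp
      have hhM : ∀ r : ℕ, r.Prime → r ∣ M → ¬ (r : ℤ) ∣ h := fun r h1 h2 =>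
        hh r h1 (h2.mul_left _)
      have hrp : ∀ r : ℕ, r.Prime → r ∣ M → ¬ r ∣ p := fun r h1 h2 h3 =>
        hpM (((Nat.prime_dvd_prime_iff_eq h1 hp).1 h3) ▸ h2)
      rw [sum_divisors_prime_pow_mul hp hM0 hpM m
        (fun a D => (sqrtCount a (h * D) : ℤ) * φ D), Finset.sum_comm]
      have inner : ∀ D ∈ M.divisors,
          ∑ kl ∈ Finset.HasAntidiagonal.antidiagonal m,
            (sqrtCount (p ^ kl.1 * (M / D)) (h * (p ^ kl.2 * D : ℕ)) : ℤ) * φ (p ^ kl.2 * D) =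
          (sqrtCount (M / D) (h * D) : ℤ) * (A * φ D + B * (legendreSym p (h * D) * φ D)) +
          (sqrtCount (M / D) (h * p * D) : ℤ) * (B * φ (p * D)) := by
        intro D hD
        have hDM := Nat.dvd_of_mem_divisors hD
        have hMD : M / D ∣ M := Nat.div_dvd_of_dvd hDM
        have hMD0 : M / D ≠ 0 := ne_zero_of_dvd_ne_zero hM0 hMD
        have hcop : p.Coprime (M / D) := hp.coprime_iff_not_dvd.2 fun h1 => hpM (h1.trans hMD)
        have hv : ¬ (p : ℤ) ∣ h * D := fun h1 => (hp'.dvd_or_dvd h1).elim hph fun h2 =>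
          hpM ((Int.natCast_dvd_natCast.1 h2).trans hDM)
        -- The count modulo M / D joins the weight g; it depends only on the parity of l because p²
        -- is the square of a unit modulo M / D.
        have key := hAB (h * D)
          (fun l => (sqrtCount (M / D) (h * (p ^ l * D : ℕ)) : ℤ) * φ (p ^ l * D)) hv ?_
        · calc _ = ∑ kl ∈ Finset.HasAntidiagonal.antidiagonal m,
                (sqrtCount (p ^ kl.1) ((p : ℤ) ^ kl.2 * (h * D)) : ℤ) *
                ((sqrtCount (M / D) (h * (p ^ kl.2 * D : ℕ)) : ℤ) * φ (p ^ kl.2 * D)) := by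
                refine Finset.sum_congr rfl fun kl _ => ?_
                rw [sqrtCount_mul (pow_ne_zero _ hp.ne_zero) hMD0 (Nat.Coprime.pow_left _ hcop),
                  show (p : ℤ) ^ kl.2 * (h * D) = h * (p ^ kl.2 * D : ℕ) by push_cast; ring]
                push_cast
                ring
            _ = _ := by
                rw [key]
                simp only [pow_zero, one_mul, pow_one]
                push_cast
                rw [mul_assoc h]
                ring
        · intro l
          rw [show h * ((p ^ (l + 2) * D : ℕ) : ℤ) = (p : ℤ) ^ 2 * (h * (p ^ l * D : ℕ)) by
            push_cast; ring, sqrtCount_unit_sq_mul hMD0 (by exact_mod_cast hcop.isCoprime),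
            show p ^ (l + 2) * D = p ^ 2 * (p ^ l * D) by ring, hφ p hp hpN]
      -- The induction hypothesis is used twice: with h for the g(0) part and with h p for the g(1)
      -- part.
      rw [Finset.sum_congr rfl inner, Finset.sum_add_distrib,
        hsum h (fun D => A * φ D + B * (legendreSym p (h * D) * φ D)) hhM ?_,
        hsum (h * p) (fun D => B * φ (p * D)) ?_ ?_]
      · simp only [Multiset.map_add, Multiset.map_nsmul, Multiset.map_map, Multiset.sum_add,
          Multiset.sum_nsmul, Function.comp_def]
        have e1 : ∀ x ∈ W, J(h * x.1 | x.2) * (A * φ x.1 + B * (legendreSym p (h * x.1) * φ x.1)) =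
            A * (J(h * x.1 | x.2) * φ x.1) + B * (J(h * x.1 | p * x.2) * φ x.1) := by
          intro x hx
          have hx2 : x.2 ≠ 0 := by
            rintro h0
            have := (hW x hx).2.2.1
            simp [h0] at this
          rw [jacobiSym.mul_right' _ hp.ne_zero hx2, ← jacobiSym.legendreSym.to_jacobiSym p]
          ring
        rw [Multiset.map_congr rfl e1, Multiset.sum_map_add, Multiset.sum_map_mul_left,
          Multiset.sum_map_mul_left]
        have e2 : ∀ x ∈ W, J(h * p * x.1 | x.2) * (B * φ (p * x.1)) =
            B * (J(h * (p * x.1 : ℕ) | x.2) * φ (p * x.1)) := by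
          intro x _
          push_cast
          rw [mul_assoc h]
          ring
        rw [Multiset.map_congr rfl e2, Multiset.sum_map_mul_left]
        simp
      · intro r h1 h2 h3
        rcases (Nat.prime_iff_prime_int.1 h1).dvd_or_dvd h3 with h4 | h4
        · exact hhM r h1 h2 h4
        · exact hrp r h1 h2 (Int.natCast_dvd_natCast.1 h4)
      · intro r h1 h2 x
        rw [mul_left_comm, hφ r h1 (h2.mul_left _)]
      · intro r h1 h2 x
        have h3 : ((r : ℤ) : ZMod p) ≠ 0 := by
          rw [Ne, ZMod.intCast_zmod_eq_zero_iff_dvd, Int.natCast_dvd_natCast]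
          intro h4
          exact hpM (((Nat.prime_dvd_prime_iff_eq hp h1).1 h4) ▸ h2)
        rw [hφ r h1 (h2.mul_left _), show h * ((r ^ 2 * x : ℕ) : ℤ) = (r : ℤ) ^ 2 * (h * x) by
          push_cast; ring, legendreSym.mul, legendreSym.sq_one' p h3, one_mul]

/-! ### The local factor at 2 and its reflection -/

/-- The contribution of the prime `2`: weighted counts of square roots modulo powers of two. -/
def twoAdicSum (e m : ℕ) (x j : ℤ) : ℤ :=
  ∑ kl ∈ Finset.HasAntidiagonal.antidiagonal m,
    (sqrtCount (2 ^ (e + kl.1)) (2 ^ kl.2 * x) : ℤ) * j ^ kl.2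

lemma sqrtCount_two_pow_add_two (k l : ℕ) (v : ℤ) :
    sqrtCount (2 ^ (k + 2)) (2 ^ (l + 2) * v) = 2 * sqrtCount (2 ^ k) (2 ^ l * v) := by
  simpa using sqrtCount_prime_pow_add_two Nat.prime_two k l v

lemma sqrtCount_two_pow_two_mul (k : ℕ) {v : ℤ} (hv : v % 2 = 1) :
    sqrtCount (2 ^ (k + 2)) (2 * v) = 0 := by
  have := sqrtCount_prime_pow_of_exact_dvd Nat.prime_two k (v := v) (by push_cast; omega)
  simpa using this

lemma twoAdicSum_zero_zero (x j : ℤ) : twoAdicSum 0 0 x j = 1 := by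
  simp [twoAdicSum]

lemma twoAdicSum_zero_one (x j : ℤ) : twoAdicSum 0 1 x j = 1 + j := by
  simp [twoAdicSum, Finset.Nat.sum_antidiagonal_succ, sqrtCount_two]
  ring

lemma twoAdicSum_zero_two {x j : ℤ} (hx : x % 2 = 1) (hj : j ^ 2 = 1) :
    twoAdicSum 0 2 x j = (if x % 4 = 1 then 2 else 0) + 1 + j := by
  simp [twoAdicSum, Finset.Nat.sum_antidiagonal_succ, sqrtCount_two, sqrtCount_four hx, hj]
  ring

lemma twoAdicSum_zero_three {x j : ℤ} (hx : x % 2 = 1) (hj : j ^ 2 = 1) :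
    twoAdicSum 0 3 x j = (if x % 8 = 1 then 4 else 0) + 1 + j := by
  have h8 := sqrtCount_two_pow 0 hx
  have h4 := sqrtCount_two_pow_two_mul 0 hx
  norm_num at h8 h4
  simp [twoAdicSum, Finset.Nat.sum_antidiagonal_succ, sqrtCount_two, h8, h4, hj]
  linear_combination j * hj

lemma sqrtCount_four_four_mul (x : ℤ) : sqrtCount 4 (4 * x) = 2 := by
  simpa using sqrtCount_two_pow_add_two 0 0 x

lemma sqrtCount_eight_four_mul (x : ℤ) : sqrtCount 8 (4 * x) = 2 := by
  simpa [sqrtCount_two] using sqrtCount_two_pow_add_two 1 0 x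

lemma twoAdicSum_two_zero {x : ℤ} (hx : x % 2 = 1) (j : ℤ) :
    twoAdicSum 2 0 x j = if x % 4 = 1 then 2 else 0 := by
  simp [twoAdicSum, sqrtCount_four hx]

lemma twoAdicSum_two_one {x : ℤ} (hx : x % 2 = 1) (j : ℤ) :
    twoAdicSum 2 1 x j = if x % 8 = 1 then 4 else 0 := by
  have h8 := sqrtCount_two_pow 0 hx
  have h4 := sqrtCount_two_pow_two_mul 0 hx
  norm_num at h8 h4
  simp [twoAdicSum, Finset.Nat.sum_antidiagonal_succ, h8, h4]

lemma twoAdicSum_two_two {x j : ℤ} (hx : x % 2 = 1) (hj : j ^ 2 = 1) :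
    twoAdicSum 2 2 x j = (if x % 8 = 1 then 4 else 0) + 2 := by
  have h8 := sqrtCount_two_pow 1 hx
  have h4 := sqrtCount_two_pow_two_mul 1 hx
  norm_num at h8 h4
  simp [twoAdicSum, Finset.Nat.sum_antidiagonal_succ, h8, h4, sqrtCount_four_four_mul, hj]
  ring

lemma twoAdicSum_two_three {x j : ℤ} (hx : x % 2 = 1) (hj : j ^ 2 = 1) :
    twoAdicSum 2 3 x j = (if x % 8 = 1 then 4 else 0) + 2 + 2 * j := by
  have h8 := sqrtCount_two_pow 2 hx
  have h4 := sqrtCount_two_pow_two_mul 2 hx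
  have h3 := sqrtCount_four_four_mul (2 * x)
  rw [← mul_assoc] at h3
  norm_num at h8 h4 h3
  simp [twoAdicSum, Finset.Nat.sum_antidiagonal_succ, h8, h4, h3, sqrtCount_eight_four_mul, hj]
  linear_combination 2 * j * hj

lemma pow_add_pow_succ_of_sq_eq_one {j : ℤ} (hj : j ^ 2 = 1) (m : ℕ) :
    j ^ (m + 1) + j ^ m = 1 + j := by
  induction m with
  | zero => ring
  | succ m ih => linear_combination ih + j ^ m * hj

/-- The interior terms double the sum for m. Of the boundary terms, moduli 1 and 2 give 1 + j, the
full modulus 2^(m+4) gives 4 or 0, and l = 1 gives 0. -/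
lemma twoAdicSum_zero_add_four (m : ℕ) {x j : ℤ} (hx : x % 2 = 1) (hj : j ^ 2 = 1) :
    twoAdicSum 0 (m + 4) x j =
      2 * twoAdicSum 0 m x j + (1 + j) + if x % 8 = 1 then 4 else 0 := by
  unfold twoAdicSum
  rw [sum_antidiagonal_add_four m
    (fun k l => (sqrtCount (2 ^ (0 + k)) (2 ^ l * x) : ℤ) * j ^ l), Finset.mul_sum]
  have h8 := sqrtCount_two_pow (m + 1) hx
  have h4 := sqrtCount_two_pow_two_mul (m + 1) hx
  have hjm : ∀ l, j ^ (l + 2) = j ^ l := fun l => by rw [pow_add, hj, mul_one]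
  simp only [zero_add, pow_zero, one_mul, mul_one, sqrtCount_one, pow_one, sqrtCount_two, h8, h4,
    sqrtCount_two_pow_add_two, hjm]
  rw [← pow_add_pow_succ_of_sq_eq_one hj (m + 3), hjm (m + 1 + 1), hjm (m + 1), hjm m]
  push_cast
  simp only [mul_assoc]
  ring

lemma twoAdicSum_two_add_four (m : ℕ) {x j : ℤ} (hx : x % 2 = 1) (hj : j ^ 2 = 1) :
    twoAdicSum 2 (m + 4) x j =
      2 * twoAdicSum 2 m x j + 2 * (1 + j) + if x % 8 = 1 then 4 else 0 := by
  unfold twoAdicSum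
  rw [sum_antidiagonal_add_four m
    (fun k l => (sqrtCount (2 ^ (2 + k)) (2 ^ l * x) : ℤ) * j ^ l), Finset.mul_sum]
  have h8 := sqrtCount_two_pow (m + 3) hx
  have h4 := sqrtCount_two_pow_two_mul (m + 3) hx
  have hjm : ∀ l, j ^ (l + 2) = j ^ l := fun l => by rw [pow_add, hj, mul_one]
  have ha : sqrtCount (2 ^ (2 + 0)) (2 ^ (m + 4) * x) = 2 := by
    rw [show (2 : ℤ) ^ (m + 4) * x = 4 * (2 ^ (m + 2) * x) by ring]
    exact sqrtCount_four_four_mul _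
  have hb : sqrtCount (2 ^ (2 + 1)) (2 ^ (m + 3) * x) = 2 := by
    rw [show (2 : ℤ) ^ (m + 3) * x = 4 * (2 ^ (m + 1) * x) by ring]
    exact sqrtCount_eight_four_mul _
  rw [show 2 + (m + 4) = m + 3 + 3 by ring, show 2 + (m + 3) = m + 3 + 2 by ring]
  simp only [ha, hb, pow_zero, one_mul, mul_one, pow_one, h8, h4, ← add_assoc,
    sqrtCount_two_pow_add_two, hjm]
  rw [← pow_add_pow_succ_of_sq_eq_one hj (m + 3), hjm (m + 1 + 1), hjm (m + 1), hjm m]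
  push_cast
  simp only [mul_assoc]
  ring

lemma χ₈_intCast_sq {x : ℤ} (hx : x % 2 = 1) : (ZMod.χ₈ x) ^ 2 = 1 := by
  rw [ZMod.χ₈_int_eq_if_mod_eight]
  split_ifs <;> first | rfl | omega

/-- The boundary terms of the two recursions satisfy the reflection by themselves, independently of
m. For m = 3 they are the whole sum. -/
lemma twoAdic_boundary_reflection {c d : ℤ} (hc : c % 2 = 1) (hd : d % 2 = 1) :
    2 * ((1 + ZMod.χ₈ d) + if c % 8 = 1 then 4 else 0) *
        (if d % 4 = 3 ∧ c % 4 = 3 then -1 else 1) =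
      (2 * (1 + ZMod.χ₈ c) + if d % 8 = 1 then 4 else 0) +
        ZMod.χ₄ c * (2 * (1 + ZMod.χ₈ c) + if (-d) % 8 = 1 then 4 else 0) := by
  simp only [ZMod.χ₄_int_eq_if_mod_four, ZMod.χ₈_int_eq_if_mod_eight]
  split_ifs <;> first | rfl | omega

/-- Reflection for the prime `2`, with the full sum on the side of modulus `4 * 2 ^ k`. -/
lemma twoAdicSum_reflection (m : ℕ) {c d : ℤ} (hc : c % 2 = 1) (hd : d % 2 = 1) :
    2 * twoAdicSum 0 m c (ZMod.χ₈ d) * (if d % 4 = 3 ∧ c % 4 = 3 then -1 else 1) =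
      twoAdicSum 2 m d (ZMod.χ₈ c) + ZMod.χ₄ c * twoAdicSum 2 m (-d) (ZMod.χ₈ c) := by
  have hdn : (-d) % 2 = 1 := by omega
  induction m using Nat.strong_induction_on with
  | _ m ih =>
  match m with
  | 0 =>
    simp only [twoAdicSum_zero_zero, twoAdicSum_two_zero hd, twoAdicSum_two_zero hdn,
      ZMod.χ₄_int_eq_if_mod_four]
    clear ih
    split_ifs <;> first | rfl | omega
  | 1 =>
    simp only [twoAdicSum_zero_one, twoAdicSum_two_one hd, twoAdicSum_two_one hdn,
      ZMod.χ₄_int_eq_if_mod_four, ZMod.χ₈_int_eq_if_mod_eight]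
    split_ifs <;> first | rfl | omega
  | 2 =>
    rw [twoAdicSum_zero_two hc (χ₈_intCast_sq hd), twoAdicSum_two_two hd (χ₈_intCast_sq hc),
      twoAdicSum_two_two hdn (χ₈_intCast_sq hc)]
    simp only [ZMod.χ₄_int_eq_if_mod_four, ZMod.χ₈_int_eq_if_mod_eight]
    split_ifs <;> first | rfl | omega
  | 3 =>
    rw [twoAdicSum_zero_three hc (χ₈_intCast_sq hd), twoAdicSum_two_three hd (χ₈_intCast_sq hc),
      twoAdicSum_two_three hdn (χ₈_intCast_sq hc)]
    linear_combination twoAdic_boundary_reflection hc hd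
  | m + 4 =>
    have h := ih m (by omega)
    rw [twoAdicSum_zero_add_four m hc (χ₈_intCast_sq hd), twoAdicSum_two_add_four m hd (χ₈_intCast_sq hc),
      twoAdicSum_two_add_four m hdn (χ₈_intCast_sq hc)]
    linear_combination 2 * h + twoAdic_boundary_reflection hc hd

lemma χ₈_neg (x : ℤ) : ZMod.χ₈ ((-x : ℤ) : ZMod 8) = ZMod.χ₈ x := by
  simp only [ZMod.χ₈_int_eq_if_mod_eight]
  split_ifs <;> first | rfl | omega

/-- Reflection for the prime `2`, with the full sum on the side of modulus `2 ^ k`. -/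
lemma twoAdicSum_reflection' (m : ℕ) {c d : ℤ} (hc : c % 2 = 1) (hd : d % 2 = 1) :
    (twoAdicSum 0 m c (ZMod.χ₈ d) + ZMod.χ₄ d * twoAdicSum 0 m (-c) (ZMod.χ₈ d)) *
        (if d % 4 = 3 ∧ c % 4 = 3 then -1 else 1) = twoAdicSum 2 m d (ZMod.χ₈ c) := by
  have h1 := twoAdicSum_reflection m hc hd
  -- Since χ₄ is odd and χ₈ is even, adding the reflections at c and -c cancels the terms at -d.
  have h2 := twoAdicSum_reflection m (c := -c) (by omega) hd
  have hs : (if d % 4 = 3 ∧ (-c) % 4 = 3 then -1 else 1 : ℤ) =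
      ZMod.χ₄ d * if d % 4 = 3 ∧ c % 4 = 3 then -1 else 1 := by
    simp only [ZMod.χ₄_int_eq_if_mod_four]
    split_ifs <;> first | rfl | omega
  have h4 : ZMod.χ₄ ((-c : ℤ) : ZMod 4) = -ZMod.χ₄ c := by
    simp only [ZMod.χ₄_int_eq_if_mod_four]
    split_ifs <;> first | rfl | omega
  rw [χ₈_neg, hs, h4] at h2
  refine mul_left_cancel₀ (two_ne_zero (α := ℤ)) ?_
  linear_combination h1 + h2

/-! ### Reflection of divisor sums -/

/-- The count modulo a power of 2 serves as the weight φ, and (2 | d)^l = χ₈(d)^l enters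
`twoAdicSum`. One W serves every e and s, so all the sums can be compared pair by pair. -/
lemma exists_weights_sum_divisors (m : ℕ) {N : ℕ} (hN : Odd N) :
    ∃ W : Multiset (ℕ × ℕ), W.map Prod.swap = W ∧ (∀ x ∈ W, x.1 % 2 = 1 ∧ x.2 % 2 = 1) ∧
      ∀ (e : ℕ) (s : ℤ), s = 1 ∨ s = -1 →
        ∑ D ∈ (2 ^ m * N).divisors, (sqrtCount (2 ^ e * (2 ^ m * N / D)) (s * D) : ℤ) =
          (W.map fun x => J(x.1 | x.2) *
            (J(s | x.2) * twoAdicSum e m (s * x.1) (ZMod.χ₈ x.2))).sum := by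
  obtain ⟨W, hswap, hW, hsum⟩ := exists_symmetric_weights hN
  have hodd : ∀ x ∈ W, x.1 % 2 = 1 ∧ x.2 % 2 = 1 := fun x hx =>
    ⟨Nat.odd_iff.1 (Nat.coprime_two_right.1 (hW x hx).2.1),
      Nat.odd_iff.1 (Nat.coprime_two_right.1 (hW x hx).2.2.1)⟩
  have hN0 : N ≠ 0 := by rintro rfl; simp at hN
  refine ⟨W, hswap, hodd, fun e s hs => ?_⟩
  have hs1 : s ^ 2 = 1 := by rcases hs with rfl | rfl <;> norm_num
  rw [sum_divisors_prime_pow_mul Nat.prime_two hN0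
    (by simpa [← Nat.odd_iff, Nat.two_dvd_ne_zero] using hN) m
    (fun a D => (sqrtCount (2 ^ e * a) (s * D) : ℤ))]
  have step : ∀ kl ∈ Finset.HasAntidiagonal.antidiagonal m,
      ∑ D ∈ N.divisors, (sqrtCount (2 ^ e * (2 ^ kl.1 * (N / D))) (s * (2 ^ kl.2 * D : ℕ)) : ℤ) =
      (W.map fun x => J(x.1 | x.2) * (J(s | x.2) *
        ((sqrtCount (2 ^ (e + kl.1)) (2 ^ kl.2 * (s * x.1)) : ℤ) * ZMod.χ₈ x.2 ^ kl.2))).sum := by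
    intro kl _
    have h1 := hsum (s * 2 ^ kl.2)
      (fun D => (sqrtCount (2 ^ (e + kl.1)) (s * 2 ^ kl.2 * D) : ℤ)) ?_ ?_
    · calc _ = ∑ D ∈ N.divisors, (sqrtCount (N / D) (s * 2 ^ kl.2 * D) : ℤ) *
            (sqrtCount (2 ^ (e + kl.1)) (s * 2 ^ kl.2 * D) : ℤ) := by
            refine Finset.sum_congr rfl fun D hD => ?_
            have hND : N / D ∣ N := Nat.div_dvd_of_dvd (Nat.dvd_of_mem_divisors hD)
            have hc : (2 ^ (e + kl.1)).Coprime (N / D) :=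
              Nat.Coprime.pow_left _ (Nat.coprime_two_left.2 (Odd.of_dvd_nat hN hND))
            rw [← mul_assoc, ← pow_add, sqrtCount_mul (by positivity)
              (ne_zero_of_dvd_ne_zero hN0 hND) hc]
            push_cast
            rw [mul_assoc s]
            ring
        _ = _ := by
            rw [h1]
            refine congrArg _ (Multiset.map_congr rfl fun x hx => ?_)
            rw [jacobiSym.mul_left, jacobiSym.mul_left, jacobiSym.pow_left,
              jacobiSym.at_two (Nat.odd_iff.2 (hodd x hx).2),
              show s * 2 ^ kl.2 * (x.1 : ℤ) = 2 ^ kl.2 * (s * x.1) by ring]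
            ring
    · intro p hp hpN hdvd
      have hp2 : Odd p := Odd.of_dvd_nat hN hpN
      have hp' := Nat.prime_iff_prime_int.1 hp
      rcases hp'.dvd_or_dvd hdvd with h | h
      · exact hp'.not_isUnit (isUnit_of_dvd_one (hs1 ▸ dvd_pow h two_ne_zero))
      · have h2 := hp'.dvd_of_dvd_pow h
        have := (Nat.prime_dvd_prime_iff_eq hp Nat.prime_two).1 (by exact_mod_cast h2)
        subst this
        exact absurd hp2 (by decide)
    · intro p hp hpN x
      have hc : p.Coprime (2 ^ (e + kl.1)) :=
        Nat.Coprime.pow_right _ (Nat.coprime_two_right.2 (Odd.of_dvd_nat hN hpN))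
      rw [show s * 2 ^ kl.2 * ((p ^ 2 * x : ℕ) : ℤ) = (p : ℤ) ^ 2 * (s * 2 ^ kl.2 * x) by
        push_cast; ring, sqrtCount_unit_sq_mul (by positivity) (by exact_mod_cast hc.isCoprime)]
  rw [Finset.sum_congr rfl step]
  refine (Multiset.sum_map_sum_map _ _).trans
    (congrArg _ (Multiset.map_congr rfl fun x _ => ?_))
  rw [twoAdicSum, Finset.mul_sum, Finset.mul_sum]
  rfl

lemma sum_map_jacobiSym_swap {W : Multiset (ℕ × ℕ)} (hswap : W.map Prod.swap = W)
    (hW : ∀ x ∈ W, x.1 % 2 = 1 ∧ x.2 % 2 = 1) (F : ℕ → ℕ → ℤ) :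
    (W.map fun x => J(x.1 | x.2) * F x.1 x.2).sum =
      (W.map fun x => J(x.1 | x.2) *
        ((if x.2 % 4 = 3 ∧ x.1 % 4 = 3 then -1 else 1) * F x.2 x.1)).sum := by
  nth_rewrite 1 [← hswap]
  rw [Multiset.map_map]
  refine congrArg _ (Multiset.map_congr rfl fun x hx => ?_)
  obtain ⟨h1, h2⟩ := hW x hx
  simp only [Function.comp_apply, Prod.fst_swap, Prod.snd_swap]
  rw [← jacobiSym.quadratic_reciprocity_if h2 h1]
  split_ifs <;> ring

/-- Reflection for counts of square roots over the divisors of a positive integer. -/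
lemma sum_sqrtCount_reflection {n : ℕ} (hn : n ≠ 0) :
    2 * ∑ D ∈ n.divisors, (sqrtCount (n / D) D : ℤ) =
        ∑ D ∈ n.divisors, (sqrtCount (4 * (n / D)) D : ℤ) +
          ∑ D ∈ n.divisors, (sqrtCount (4 * (n / D)) (-D) : ℤ) ∧
      ∑ D ∈ n.divisors, (sqrtCount (n / D) D : ℤ) + ∑ D ∈ n.divisors, (sqrtCount (n / D) (-D) : ℤ) =
        ∑ D ∈ n.divisors, (sqrtCount (4 * (n / D)) D : ℤ) := by
  obtain ⟨m, N, hN, rfl⟩ := Nat.exists_eq_two_pow_mul_odd hn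
  obtain ⟨W, hswap, hW, hsum⟩ := exists_weights_sum_divisors m hN
  have a1 := hsum 0 1 (Or.inl rfl)
  have a2 := hsum 0 (-1) (Or.inr rfl)
  have b1 := hsum 2 1 (Or.inl rfl)
  have b2 := hsum 2 (-1) (Or.inr rfl)
  simp only [pow_zero, one_mul, neg_mul, jacobiSym.one_left, show (2 : ℕ) ^ 2 = 4 from rfl]
    at a1 a2 b1 b2
  have hsign : ∀ x : ℕ × ℕ, (if x.2 % 4 = 3 ∧ x.1 % 4 = 3 then -1 else 1 : ℤ) =
      if (x.2 : ℤ) % 4 = 3 ∧ (x.1 : ℤ) % 4 = 3 then -1 else 1 := by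
    intro x
    split_ifs <;> first | rfl | omega
  have hsq : ∀ P : Prop, ∀ [Decidable P], (if P then -1 else 1 : ℤ) ^ 2 = 1 := by
    intro P _
    split_ifs <;> norm_num
  have e1 : ∀ x ∈ W, J(x.1 | x.2) * ((if x.2 % 4 = 3 ∧ x.1 % 4 = 3 then -1 else 1) *
      twoAdicSum 2 m x.2 (ZMod.χ₈ x.1)) = J(x.1 | x.2) * twoAdicSum 0 m x.1 (ZMod.χ₈ x.2) +
      J(x.1 | x.2) * (J(-1 | x.2) * twoAdicSum 0 m (-x.1) (ZMod.χ₈ x.2)) := by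
    intro x hx
    obtain ⟨h1, h2⟩ := hW x hx
    have h := twoAdicSum_reflection' m (c := x.1) (d := x.2) (by omega) (by omega)
    rw [← hsign] at h
    simp only [Int.cast_natCast] at h
    rw [jacobiSym.at_neg_one (Nat.odd_iff.2 h2), ← h]
    linear_combination J(x.1 | x.2) * (twoAdicSum 0 m x.1 (ZMod.χ₈ x.2) +
      ZMod.χ₄ x.2 * twoAdicSum 0 m (-x.1) (ZMod.χ₈ x.2)) * hsq (x.2 % 4 = 3 ∧ x.1 % 4 = 3)
  have e2 : ∀ x ∈ W, J(x.1 | x.2) * ((if x.2 % 4 = 3 ∧ x.1 % 4 = 3 then -1 else 1) *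
      twoAdicSum 2 m x.2 (ZMod.χ₈ x.1)) +
      J(x.1 | x.2) * ((if x.2 % 4 = 3 ∧ x.1 % 4 = 3 then -1 else 1) *
        (J(-1 | x.1) * twoAdicSum 2 m (-x.2) (ZMod.χ₈ x.1))) =
      2 * (J(x.1 | x.2) * twoAdicSum 0 m x.1 (ZMod.χ₈ x.2)) := by
    intro x hx
    obtain ⟨h1, h2⟩ := hW x hx
    have h := twoAdicSum_reflection m (c := x.1) (d := x.2) (by omega) (by omega)
    rw [← hsign] at h
    simp only [Int.cast_natCast] at h
    rw [jacobiSym.at_neg_one (Nat.odd_iff.2 h1)]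
    generalize hk : (if x.2 % 4 = 3 ∧ x.1 % 4 = 3 then -1 else 1 : ℤ) = k at *
    have hk2 : k ^ 2 = 1 := hk ▸ hsq _
    linear_combination (-J(x.1 | x.2) * k) * h +
      2 * J(x.1 | x.2) * twoAdicSum 0 m x.1 (ZMod.χ₈ x.2) * hk2
  rw [a1, a2, b1, b2]
  -- Only the sums with modulus factor 4 are swapped; afterwards both sides carry the same symbol (c
  -- | d) and agree term by term.
  rw [sum_map_jacobiSym_swap hswap hW (fun c d => twoAdicSum 2 m c (ZMod.χ₈ d)),
    sum_map_jacobiSym_swap hswap hW (fun c d => J(-1 | d) * twoAdicSum 2 m (-c) (ZMod.χ₈ d)),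
    ← Multiset.sum_map_add, ← Multiset.sum_map_add, ← Multiset.sum_map_mul_left,
    Multiset.map_congr rfl e1, Multiset.map_congr rfl e2]
  exact ⟨rfl, rfl⟩

/-! ### Quadratic polynomials and real roots -/

/-- The polynomial `a x² + b x + c`. -/
noncomputable def quadraticPoly (a b c : ℤ) : ℤ[X] :=
  C a * X ^ 2 + C b * X + C c

/-- The discriminant `b² - 4 a c` of `f = a x² + b x + c`. -/
def quadDisc (f : ℤ[X]) : ℤ :=
  f.coeff 1 ^ 2 - 4 * f.coeff 2 * f.coeff 0

section quadraticPoly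

variable (a b c : ℤ)

@[simp] lemma quadraticPoly_coeff_two : (quadraticPoly a b c).coeff 2 = a := by
  simp only [quadraticPoly, coeff_add, coeff_C_mul, coeff_X_pow, coeff_X, coeff_C]
  norm_num

@[simp] lemma quadraticPoly_coeff_one : (quadraticPoly a b c).coeff 1 = b := by
  simp only [quadraticPoly, coeff_add, coeff_C_mul, coeff_X_pow, coeff_X, coeff_C]
  norm_num

@[simp] lemma quadraticPoly_coeff_zero : (quadraticPoly a b c).coeff 0 = c := by
  simp only [quadraticPoly, coeff_add, coeff_C_mul, coeff_X_pow, coeff_X, coeff_C]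
  norm_num

lemma quadraticPoly_comp (t : ℤ) : (quadraticPoly a b c).comp (X + C t) =
    quadraticPoly a (b + 2 * a * t) (a * t ^ 2 + b * t + c) := by
  simp only [quadraticPoly, add_comp, mul_comp, C_comp, pow_comp, X_comp, C_add, C_mul, C_pow,
    C_ofNat]
  ring

end quadraticPoly

lemma eq_quadraticPoly {f : ℤ[X]} (hf : f.natDegree = 2) :
    f = quadraticPoly (f.coeff 2) (f.coeff 1) (f.coeff 0) :=
  eq_quadratic_of_degree_le_two (natDegree_le_iff_degree_le.1 hf.le)

lemma coeff_two_ne_zero {f : ℤ[X]} (hf : f.natDegree = 2) : f.coeff 2 ≠ 0 := by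
  intro h
  have h0 : f.leadingCoeff = 0 := by rw [leadingCoeff, hf, h]
  rw [leadingCoeff_eq_zero] at h0
  simp [h0] at hf

lemma superdisc_eq (f : ℤ[X]) : superdisc f = f.coeff 2 * quadDisc f := rfl

lemma realRooted_iff {f : ℤ[X]} (hf : f.natDegree = 2) : RealRooted f ↔ 0 ≤ quadDisc f := by
  have ha := coeff_two_ne_zero hf
  have heval : ∀ z : ℂ, aeval z f = f.coeff 2 * z ^ 2 + f.coeff 1 * z + f.coeff 0 := by
    intro z
    conv_lhs => rw [eq_quadraticPoly hf]
    simp [quadraticPoly]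
  unfold RealRooted quadDisc
  simp only [heval]
  generalize f.coeff 2 = a at *
  generalize f.coeff 1 = b at *
  generalize f.coeff 0 = c at *
  have haR : (a : ℝ) ≠ 0 := by exact_mod_cast ha
  constructor
  · intro h
    by_contra! hneg
    set r : ℝ := Real.sqrt (4 * a * c - b ^ 2) with hr
    have hpos : (0 : ℝ) < 4 * a * c - b ^ 2 := by
      have : 0 < 4 * a * c - b ^ 2 := by linarith
      exact_mod_cast this
    have hr2 : r ^ 2 = 4 * a * c - b ^ 2 := Real.sq_sqrt hpos.le
    have hr0 : 0 < r := Real.sqrt_pos.2 hpos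
    -- A non-real root from the quadratic formula.
    have him := h ⟨-b / (2 * a), r / (2 * a)⟩ ?_
    · simp only [div_eq_zero_iff] at him
      rcases him with h1 | h1
      · exact hr0.ne' h1
      · exact haR (by linarith)
    · apply Complex.ext
      · simp [pow_two]
        field_simp
        linear_combination -hr2
      · simp [pow_two]
        field_simp
        ring
  · intro h z hz
    have hre := congrArg Complex.re hz
    have him := congrArg Complex.im hz
    simp [pow_two] at hre him
    have hD : (0 : ℝ) ≤ b ^ 2 - 4 * a * c := by exact_mod_cast h
    by_contra hy
    -- The imaginary part of f(z) is (2a Re z + b) Im z.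
    have h1 : 2 * a * z.re + b = 0 := by
      refine (mul_eq_zero.1 (?_ : (2 * a * z.re + b) * z.im = 0)).resolve_right hy
      linear_combination him
    have h2 : (b : ℝ) ^ 2 - 4 * a * c = -(2 * a * z.im) ^ 2 := by
      linear_combination (-4 * a) * hre + (2 * a * z.re + b) * h1
    have h3 : 0 < (2 * a * z.im) ^ 2 := by positivity
    linarith

/-! ### Translation classes as residues -/

/-- The number of residues `b` modulo `μ * a` with `b² ≡ D` modulo `μ² * a`. -/
def middleCount (μ a : ℕ) (D : ℤ) : ℕ :=
  Nat.count (fun b : ℕ => ((μ ^ 2 * a : ℕ) : ℤ) ∣ (b : ℤ) ^ 2 - D) (μ * a)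

/-- Because μ ∣ 2, the condition mod μ² a already has period μ a in b. -/
lemma mul_middleCount {μ : ℕ} (hμ : μ ∣ 2) (a : ℕ) (D : ℤ) :
    μ * middleCount μ a D = sqrtCount (μ ^ 2 * a) D := by
  obtain ⟨κ, hκ⟩ := hμ
  have hκ' : (2 : ℤ) = μ * κ := by exact_mod_cast hκ
  rw [middleCount, sqrtCount, ← count_mul_of_periodic]
  · congr 1
    ring
  · intro b
    push_cast
    rw [show ((μ : ℤ) * a + b) ^ 2 - D = (b ^ 2 - D) + μ ^ 2 * a * (a + κ * b) by
      linear_combination (μ : ℤ) * a * b * hκ', dvd_add_left (dvd_mul_right _ _)]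

section Classes

variable {κ μ : ℕ} {n : ℤ} {S : Finset ℤ}

/-- The representative with discriminant `κ² * D` and middle coefficient `κ * b`. -/
noncomputable def representative (κ μ : ℕ) (n : ℤ) (x : Σ _ : ℤ, ℕ) : ℤ[X] :=
  quadraticPoly (n / x.1) (κ * x.2) (((x.2 : ℤ) ^ 2 - x.1) / (μ ^ 2 * (n / x.1)))

/-- Indices of the representatives with discriminant in `κ² * S`. -/
def representativeIndices (μ : ℕ) (n : ℤ) (S : Finset ℤ) : Finset (Σ _ : ℤ, ℕ) :=
  S.sigma fun D => (Finset.range (μ * (n / D).natAbs)).filter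
    fun b => ((μ ^ 2 * (n / D).natAbs : ℕ) : ℤ) ∣ (b : ℤ) ^ 2 - D

lemma mem_representativeIndices {x : Σ _ : ℤ, ℕ} : x ∈ representativeIndices μ n S ↔
    x.1 ∈ S ∧ (x.2 : ℤ) < μ * |n / x.1| ∧ (μ ^ 2 * (n / x.1)) ∣ (x.2 : ℤ) ^ 2 - x.1 := by
  simp only [representativeIndices, Finset.mem_sigma, Finset.mem_filter, Finset.mem_range]
  rw [← Int.natAbs_dvd (a := (μ : ℤ) ^ 2 * (n / x.1)), Int.natAbs_mul, Int.natAbs_pow,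
    Int.natAbs_natCast, Int.abs_eq_natAbs]
  norm_cast

lemma card_representativeIndices : (representativeIndices μ n S).card =
    ∑ D ∈ S, middleCount μ (n / D).natAbs D := by
  simp [representativeIndices, middleCount, Nat.count_eq_card_filter_range]

/-- κ = 1 treats all middle coefficients, κ = 2 the even ones. With b = κ β, translation by t moves
β by μ a t, so β may be reduced mod μ a; a = n / D is fixed by D. -/
lemma translationClasses_eq_image (hκμ : κ * μ = 2) (hn : n ≠ 0)
    (hS : ∀ D ∈ S, D ∣ n) :
    translationClasses {f ∈ quadratics (κ ^ 2 * n) |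
      (κ : ℤ) ∣ f.coeff 1 ∧ ∃ D ∈ S, quadDisc f = κ ^ 2 * D} =
    (fun x => Quotient.mk translationSetoid (representative κ μ n x)) ''
      (representativeIndices μ n S) := by
  have hκμ' : (κ : ℤ) * μ = 2 := by exact_mod_cast hκμ
  have hκ0 : (κ : ℤ) ≠ 0 := by rintro h; simp [h] at hκμ'
  have hμ0 : (μ : ℤ) ≠ 0 := by rintro h; simp [h] at hκμ'
  ext q
  constructor
  · rintro ⟨f, ⟨⟨hdeg, hI⟩, ⟨β, hβ⟩, D, hD, hfD⟩, rfl⟩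
    have ha := coeff_two_ne_zero hdeg
    rw [superdisc_eq, hfD] at hI
    unfold quadDisc at hfD
    rw [eq_quadraticPoly hdeg, hβ]
    rw [hβ] at hfD
    generalize f.coeff 2 = a at *
    generalize f.coeff 0 = c at *
    have haD : a * D = n := by
      refine mul_left_cancel₀ (pow_ne_zero 2 hκ0) ?_
      linear_combination hI
    have hD0 : D ≠ 0 := by rintro rfl; simp at haD; exact hn haD.symm
    have hnD : n / D = a := by rw [← haD, Int.mul_ediv_cancel _ hD0]
    have hμa : (μ : ℤ) * a ≠ 0 := mul_ne_zero hμ0 ha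
    have hnn : 0 ≤ β % (μ * a) := Int.emod_nonneg _ hμa
    set t : ℤ := -(β / (μ * a)) with ht
    have hmod : β % (μ * a) = β + μ * a * t := by
      rw [ht, Int.emod_def]
      ring
    have hsq : (β % (μ * a)) ^ 2 - D = μ ^ 2 * a * (a * t ^ 2 + κ * β * t + c) := by
      rw [hmod]
      refine mul_left_cancel₀ (pow_ne_zero 2 hκ0) ?_
      linear_combination hfD - (κ * μ + 2) * a * c * hκμ' - (κ ^ 2 * μ * a * β * t) * hκμ'
    refine ⟨⟨D, (β % (μ * a)).toNat⟩, ?_, ?_⟩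
    · rw [Finset.mem_coe, mem_representativeIndices]
      simp only [Int.toNat_of_nonneg hnn, hnD, hsq]
      refine ⟨hD, ?_, dvd_mul_right _ _⟩
      have := Int.emod_lt_abs β hμa
      rwa [abs_mul, Nat.abs_cast] at this
    · symm
      refine Quotient.sound ⟨t, ?_⟩
      rw [quadraticPoly_comp]
      simp only [representative, Int.toNat_of_nonneg hnn, hnD]
      rw [hsq, Int.mul_ediv_cancel_left _ (mul_ne_zero (pow_ne_zero 2 hμ0) ha), hmod]
      congr 1
      linear_combination a * t * hκμ'
  · rintro ⟨x, hx, rfl⟩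
    rw [Finset.mem_coe, mem_representativeIndices] at hx
    obtain ⟨hD, -, hdvd⟩ := hx
    obtain ⟨e, he⟩ := hS x.1 hD
    have hD0 : x.1 ≠ 0 := by intro h; rw [h, zero_mul] at he; exact hn he
    have hq : n / x.1 = e := by rw [he, Int.mul_ediv_cancel_left _ hD0]
    have he0 : e ≠ 0 := by rintro rfl; rw [mul_zero] at he; exact hn he
    rw [hq] at hdvd
    obtain ⟨c, hc⟩ := hdvd
    have hrep : representative κ μ n x = quadraticPoly e (κ * x.2) c := by
      rw [representative, hq, hc,
        Int.mul_ediv_cancel_left _ (mul_ne_zero (pow_ne_zero 2 hμ0) he0)]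
    have hdisc : quadDisc (representative κ μ n x) = κ ^ 2 * x.1 := by
      rw [hrep, quadDisc]
      simp only [quadraticPoly_coeff_two, quadraticPoly_coeff_one, quadraticPoly_coeff_zero]
      linear_combination κ ^ 2 * hc + (κ * μ + 2) * e * c * hκμ'
    refine ⟨_, ⟨⟨?_, ?_⟩, ?_, x.1, hD, hdisc⟩, rfl⟩
    · rw [hrep]
      exact natDegree_quadratic he0
    · rw [superdisc_eq, hdisc, hrep, quadraticPoly_coeff_two, he]
      ring
    · rw [hrep, quadraticPoly_coeff_one]
      exact dvd_mul_right _ _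

/-- The leading coefficient is translation invariant and determines D. Two values of b in one class
differ by a multiple of μ a, and both lie in [0, μ |a|). -/
lemma injOn_representative (hκμ : κ * μ = 2) (hn : n ≠ 0)
    (hS : ∀ D ∈ S, D ∣ n) :
    Set.InjOn (fun x => Quotient.mk translationSetoid (representative κ μ n x))
      (representativeIndices μ n S) := by
  have hκμ' : (κ : ℤ) * μ = 2 := by exact_mod_cast hκμ
  have hκ0 : (κ : ℤ) ≠ 0 := by rintro h; simp [h] at hκμ'
  rintro ⟨D, b⟩ hx ⟨D', b'⟩ hy hxy
  rw [Finset.mem_coe, mem_representativeIndices] at hx hy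
  obtain ⟨t, ht⟩ := Quotient.exact hxy
  simp only [representative, quadraticPoly_comp] at ht hx hy
  have h2 := congrArg (coeff · 2) ht
  have h1 := congrArg (coeff · 1) ht
  simp only [quadraticPoly_coeff_two, quadraticPoly_coeff_one] at h1 h2
  obtain ⟨e, he⟩ := hS D hx.1
  obtain ⟨e', he'⟩ := hS D' hy.1
  have hD0 : D ≠ 0 := by rintro rfl; simp at he; exact hn he
  have hD0' : D' ≠ 0 := by rintro rfl; simp at he'; exact hn he'
  have hq : n / D = e := by rw [he, Int.mul_ediv_cancel_left _ hD0]
  have hq' : n / D' = e' := by rw [he', Int.mul_ediv_cancel_left _ hD0']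
  rw [hq] at hx h1 h2
  rw [hq'] at hy h2
  subst h2
  have he0 : e' ≠ 0 := by rintro rfl; simp at he; exact hn he
  have hDD : D = D' := mul_right_cancel₀ he0 (he.symm.trans he')
  subst hDD
  have hb : (b' : ℤ) - b = μ * e' * t := by
    refine mul_left_cancel₀ hκ0 ?_
    linear_combination h1 - e' * t * hκμ'
  have hb0 : (b' : ℤ) - b = 0 := by
    refine Int.eq_zero_of_abs_lt_dvd (m := μ * |e'|) ?_ ?_
    · rw [hb]
      exact Dvd.dvd.mul_right (mul_dvd_mul_left _ ((abs_dvd _ _).2 dvd_rfl)) _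
    · rw [abs_lt]
      constructor <;> linarith [hx.2.1, hy.2.1, Int.natCast_nonneg b, Int.natCast_nonneg b']
  have : b = b' := by omega
  rw [this]

lemma finite_translationClasses (hκμ : κ * μ = 2) (hn : n ≠ 0)
    (hS : ∀ D ∈ S, D ∣ n) :
    (translationClasses {f ∈ quadratics (κ ^ 2 * n) |
      (κ : ℤ) ∣ f.coeff 1 ∧ ∃ D ∈ S, quadDisc f = κ ^ 2 * D}).Finite := by
  rw [translationClasses_eq_image hκμ hn hS]
  exact (Finset.finite_toSet _).image _

lemma mul_ncard_translationClasses (hκμ : κ * μ = 2) (hn : n ≠ 0)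
    (hS : ∀ D ∈ S, D ∣ n) :
    μ * (translationClasses {f ∈ quadratics (κ ^ 2 * n) |
      (κ : ℤ) ∣ f.coeff 1 ∧ ∃ D ∈ S, quadDisc f = κ ^ 2 * D}).ncard =
      ∑ D ∈ S, sqrtCount (μ ^ 2 * (n / D).natAbs) D := by
  rw [translationClasses_eq_image hκμ hn hS,
    (injOn_representative hκμ hn hS).ncard_image, Set.ncard_coe_finset,
    card_representativeIndices, Finset.mul_sum]
  exact Finset.sum_congr rfl fun D _ => mul_middleCount ⟨κ, by rw [← hκμ, mul_comm]⟩ _ _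

end Classes

/-! ### Signed divisors -/

/-- The positive divisors of `n`, as integers. -/
def posDivisors (n : ℤ) : Finset ℤ :=
  n.natAbs.divisors.map Nat.castEmbedding

/-- The negative divisors of `n`. -/
def negDivisors (n : ℤ) : Finset ℤ :=
  (posDivisors n).map (Equiv.neg ℤ).toEmbedding

section Divisors

variable {n : ℤ}

lemma mem_posDivisors {D : ℤ} (hn : n ≠ 0) : D ∈ posDivisors n ↔ D ∣ n ∧ 0 < D := by
  simp only [posDivisors, Finset.mem_map, Nat.mem_divisors, Nat.castEmbedding_apply]
  constructor
  · rintro ⟨d, ⟨hd, -⟩, rfl⟩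
    refine ⟨Int.natCast_dvd.2 hd, ?_⟩
    have := Nat.pos_of_dvd_of_pos hd (Int.natAbs_pos.2 hn)
    exact_mod_cast this
  · rintro ⟨hd, hpos⟩
    exact ⟨D.natAbs, ⟨Int.natAbs_dvd_natAbs.2 hd, Int.natAbs_ne_zero.2 hn⟩, by
      rw [Int.natCast_natAbs, abs_of_pos hpos]⟩

lemma mem_negDivisors {D : ℤ} (hn : n ≠ 0) : D ∈ negDivisors n ↔ D ∣ n ∧ D < 0 := by
  have : D ∈ negDivisors n ↔ -D ∈ posDivisors n := by
    simp [negDivisors]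
  rw [this, mem_posDivisors hn, neg_dvd, neg_pos]

lemma disjoint_pos_neg_divisors (hn : n ≠ 0) : Disjoint (posDivisors n) (negDivisors n) := by
  rw [Finset.disjoint_left]
  intro D h1 h2
  rw [mem_posDivisors hn] at h1
  rw [mem_negDivisors hn] at h2
  linarith [h1.2, h2.2]

lemma mem_pos_union_neg_divisors {D : ℤ} (hn : n ≠ 0) :
    D ∈ posDivisors n ∪ negDivisors n ↔ D ∣ n := by
  rw [Finset.mem_union, mem_posDivisors hn, mem_negDivisors hn, ← and_or_left, and_iff_left_iff_imp]
  intro h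
  have : D ≠ 0 := by rintro rfl; exact hn (zero_dvd_iff.1 h)
  exact this.lt_or_gt.symm

lemma sum_posDivisors (f : ℕ → ℤ → ℕ) :
    ∑ D ∈ posDivisors n, f (n / D).natAbs D =
      ∑ D ∈ n.natAbs.divisors, f (n.natAbs / D) D := by
  rw [posDivisors, Finset.sum_map]
  refine Finset.sum_congr rfl fun D hD => ?_
  rw [Nat.castEmbedding_apply, Int.natAbs_ediv_of_dvd
    (Int.natCast_dvd.2 (Nat.dvd_of_mem_divisors hD)), Int.natAbs_natCast]

lemma sum_negDivisors (f : ℕ → ℤ → ℕ) :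
    ∑ D ∈ negDivisors n, f (n / D).natAbs D =
      ∑ D ∈ n.natAbs.divisors, f (n.natAbs / D) (-D) := by
  rw [negDivisors, Finset.sum_map, ← sum_posDivisors fun a D => f a (-D)]
  refine Finset.sum_congr rfl fun D hD => ?_
  simp

end Divisors

/-! ### The four families of quadratics, sorted by discriminant -/

lemma quadDisc_ne_zero {n : ℤ} (hn : n ≠ 0) {f : ℤ[X]} (hf : f ∈ quadratics n) :
    quadDisc f ≠ 0 := by
  intro h
  apply hn
  rw [← hf.2, superdisc_eq, h, mul_zero]

lemma quadratics_eq {n : ℤ} (hn : n ≠ 0) : quadratics n =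
    {f ∈ quadratics (((1 : ℕ) : ℤ) ^ 2 * n) | ((1 : ℕ) : ℤ) ∣ f.coeff 1 ∧
      ∃ D ∈ posDivisors n ∪ negDivisors n, quadDisc f = ((1 : ℕ) : ℤ) ^ 2 * D} := by
  ext f
  simp only [Nat.cast_one, one_pow, one_mul, Set.mem_ofPred_eq, one_dvd, true_and,
    exists_eq_right', mem_pos_union_neg_divisors hn]
  exact ⟨fun h => ⟨h, ⟨f.coeff 2, by rw [← h.2, superdisc_eq, mul_comm]⟩⟩, fun h => h.1⟩

lemma quadratics_realRooted_eq {n : ℤ} (hn : n ≠ 0) : {f ∈ quadratics n | RealRooted f} =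
    {f ∈ quadratics (((1 : ℕ) : ℤ) ^ 2 * n) | ((1 : ℕ) : ℤ) ∣ f.coeff 1 ∧
      ∃ D ∈ posDivisors n, quadDisc f = ((1 : ℕ) : ℤ) ^ 2 * D} := by
  ext f
  simp only [Nat.cast_one, one_pow, one_mul, Set.mem_ofPred_eq, one_dvd, true_and,
    exists_eq_right', mem_posDivisors hn]
  refine and_congr_right fun h => ?_
  rw [realRooted_iff h.1, le_iff_lt_or_eq, or_iff_left (quadDisc_ne_zero hn h).symm,
    and_iff_right ⟨f.coeff 2, by rw [← h.2, superdisc_eq, mul_comm]⟩]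

lemma exists_quadDisc_eq_four_mul {n : ℤ} {f : ℤ[X]} (hf : f ∈ quadratics (4 * n))
    (h2 : 2 ∣ f.coeff 1) : ∃ D, D ∣ n ∧ quadDisc f = 4 * D := by
  obtain ⟨b, hb⟩ := h2
  have hD : quadDisc f = 4 * (b ^ 2 - f.coeff 2 * f.coeff 0) := by rw [quadDisc, hb]; ring
  refine ⟨_, ⟨f.coeff 2, ?_⟩, hD⟩
  have := hf.2
  rw [superdisc_eq, hD] at this
  linarith

lemma quadratics_even_eq {n : ℤ} (hn : n ≠ 0) : {f ∈ quadratics (4 * n) | 2 ∣ f.coeff 1} =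
    {f ∈ quadratics (((2 : ℕ) : ℤ) ^ 2 * n) | ((2 : ℕ) : ℤ) ∣ f.coeff 1 ∧
      ∃ D ∈ posDivisors n ∪ negDivisors n, quadDisc f = ((2 : ℕ) : ℤ) ^ 2 * D} := by
  ext f
  norm_num only [Set.mem_ofPred_eq, mem_pos_union_neg_divisors hn, Nat.cast_ofNat]
  exact ⟨fun h => ⟨h.1, h.2, exists_quadDisc_eq_four_mul h.1 h.2⟩, fun h => ⟨h.1, h.2.1⟩⟩

lemma quadratics_even_realRooted_eq {n : ℤ} (hn : n ≠ 0) :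
    {f ∈ quadratics (4 * n) | 2 ∣ f.coeff 1 ∧ RealRooted f} =
    {f ∈ quadratics (((2 : ℕ) : ℤ) ^ 2 * n) | ((2 : ℕ) : ℤ) ∣ f.coeff 1 ∧
      ∃ D ∈ posDivisors n, quadDisc f = ((2 : ℕ) : ℤ) ^ 2 * D} := by
  ext f
  norm_num only [Set.mem_ofPred_eq, mem_posDivisors hn, Nat.cast_ofNat]
  refine and_congr_right fun h => and_congr_right fun h2 => ?_
  rw [realRooted_iff h.1]
  constructor
  · intro h0
    obtain ⟨D, hD, hfD⟩ := exists_quadDisc_eq_four_mul h h2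
    have : quadDisc f ≠ 0 := quadDisc_ne_zero (mul_ne_zero four_ne_zero hn) h
    exact ⟨D, ⟨hD, by omega⟩, hfD⟩
  · rintro ⟨D, ⟨-, hD⟩, hfD⟩
    omega

/-- Quadratic reflection theorem. The first conjunct says, `n` being arbitrary, that all the
counts (at `n` and at `4 * n`) are counts of finite sets. -/
theorem theorem1p4 (n : ℤ) (hn : n ≠ 0) :
    (translationClasses (quadratics n)).Finite ∧
      qTwoPlus (4 * n) = q n ∧
      qTwo (4 * n) = 2 * qPlus n := by
  have hpos : ∀ D ∈ posDivisors n, D ∣ n := fun D h => ((mem_posDivisors hn).1 h).1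
  have hall : ∀ D ∈ posDivisors n ∪ negDivisors n, D ∣ n :=
    fun D h => (mem_pos_union_neg_divisors hn).1 h
  obtain ⟨h1, h2⟩ := sum_sqrtCount_reflection (Int.natAbs_ne_zero.2 hn)
  -- κ = 2, μ = 1 gives the counts at 4n with moduli |n/D|; κ = 1, μ = 2 gives twice the counts at n
  -- with moduli 4|n/D|. Real roots select the positive D.
  have e1 := mul_ncard_translationClasses (κ := 2) (μ := 1) rfl hn hpos
  have e2 := mul_ncard_translationClasses (κ := 1) (μ := 2) rfl hn hall
  have e3 := mul_ncard_translationClasses (κ := 2) (μ := 1) rfl hn hall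
  have e4 := mul_ncard_translationClasses (κ := 1) (μ := 2) rfl hn hpos
  rw [← quadratics_even_realRooted_eq hn, sum_posDivisors fun a D => sqrtCount (1 ^ 2 * a) D] at e1
  rw [← quadratics_eq hn, Finset.sum_union (disjoint_pos_neg_divisors hn),
    sum_posDivisors fun a D => sqrtCount (2 ^ 2 * a) D,
    sum_negDivisors fun a D => sqrtCount (2 ^ 2 * a) D] at e2
  rw [← quadratics_even_eq hn, Finset.sum_union (disjoint_pos_neg_divisors hn),
    sum_posDivisors fun a D => sqrtCount (1 ^ 2 * a) D,
    sum_negDivisors fun a D => sqrtCount (1 ^ 2 * a) D] at e3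
  rw [← quadratics_realRooted_eq hn, sum_posDivisors fun a D => sqrtCount (2 ^ 2 * a) D] at e4
  simp only [one_pow, one_mul, show (2 : ℕ) ^ 2 = 4 from rfl] at e1 e2 e3 e4
  refine ⟨?_, ?_, ?_⟩
  · rw [quadratics_eq hn]
    exact finite_translationClasses (κ := 1) (μ := 2) rfl hn hall
  · norm_cast at h1
    rw [← e1, ← e2] at h1
    exact mul_left_cancel₀ two_ne_zero h1
  · norm_cast at h2
    rw [← e3, ← e4] at h2
    exact h2
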